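/- Let $n\ge 1$ be an integer, let $p>2$ be a prime with $p\nmid n$, and let $q=p^r$ with $r\ge 1$. Let $\mathbb{Q}_q\subset\mathbb{C}_p$ be the unramified extension of $\mathbb{Q}_p$ of degree $r$, $\mathbb{Z}_q$ its ring of integers, with residue field $\mathbb{F}_q$. Let $\zeta_p\in\mathbb{C}_p$ be a primitive $p$-th root of unity and let $\gamma\in\mathbb{Q}_p(\zeta_p)$ satisfy $\sum_{k\ge 0}\gamma^{p^k}/p^k=0$ and $\mathrm{ord}_p(\gamma)=\frac1{p-1}$. Let $\tilde\gamma\in\mathbb{C}_p$ satisfy $\tilde\gamma^n=\gamma$. Let $t\in\mathbb{F}_q^*$ with Teichmüller lift $\bar t\in\mathbb{Z}_q$. For $(a,b)\in\mathbb{Z}^2$ put $$\omega(a,b)=\frac an+b+\frac{2n+1}{n}\max\{0,-a,-b\}\in\tfrac1n\mathbb{Z}_{\ge 0},$$ and let $$\mathcal{C}_0=\Big\{\sum_{(a,b)\in\mathbb{Z}^2}\xi(a,b)\,\tilde\gamma^{\,n\omega(a,b)}x^ay^b \;:\; \xi(a,b)\in\mathbb{Z}_q[\tilde\gamma],\ |\xi(a,b)|_p\to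 0\text{ as }\omega(a,b)\to\infty\Big\}.$$ With $\gamma_i=\sum_{k=0}^{i}\gamma^{p^k}/p^k$, let $$D_x=x\frac{\partial}{\partial x}+\sum_{i\ge 0}\gamma_ip^i\Big(nx^{np^i}-\frac{\bar t^{\,p^i}}{x^{p^i}y^{p^i}}\Big),\qquad D_y=y\frac{\partial}{\partial y}+\sum_{i\ge 0}\gamma_ip^i\Big(y^{p^i}-\frac{\bar t^{\,p^i}}{x^{p^i}y^{p^i}}\Big).$$ These are well-defined $\mathbb{Z}_q[\tilde\gamma]$-linear operators on $\mathcal{C}_0$, and they define a complex $(\Omega^\bullet_{\mathcal{C}_0},\nabla(D))$: $$\mathcal{C}_0\to\mathcal{C}_0\tfrac{dx}{x}\oplus\mathcal{C}_0\tfrac{dy}{y}\to\mathcal{C}_0\tfrac{dx}{x}\wedge\tfrac{dy}{y},\qquad \xi\mapsto D_x\xi\,\tfrac{dx}{x}+D_y\xi\,\tfrac{dy}{y},\quad \xi_1\tfrac{dx}{x}+\xi_2\tfrac{dy}{y}\mapsto(D_x\xi_2-D_y\xi_1)\tfrac{dx}{x}\wedge\tfrac{dy}{y}.$$ Let $\varepsilon_i=x^i$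 for $0\le i\le n$, $\varepsilon_i=x^{i-n}y$ for $n+1\le i\le 2n$, and $\tilde\varepsilon_i=\tilde\gamma^{\,n\omega(\varepsilon_i)}\varepsilon_i$, where $\omega(\varepsilon_i)$ is the weight of the exponent of $\varepsilon_i$. Then the classes of $\tilde\varepsilon_i$, $0\le i\le 2n$, form a basis of the $\mathbb{Z}_q[\tilde\gamma]$-module $H^2(\Omega^\bullet_{\mathcal{C}_0},\nabla(D))$. More precisely, $$\mathcal{C}_0=\bigoplus_{i=0}^{2n}\mathbb{Z}_q[\tilde\gamma]\,\tilde\varepsilon_i\;\oplus\;(D_x\mathcal{C}_0+D_y\mathcal{C}_0).$$ -/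

import Mathlib

open Filter Topology

noncomputable section

namespace DworkCohomology

/-! ### The weight function -/

/-- `m(a,b) = max {0, -a, -b}`. -/
def mMax (u : ℤ × ℤ) : ℤ := max 0 (max (-u.1) (-u.2))

/-- The weight function `ω(a,b) = a/n + b + ((2n+1)/n) m(a,b)` of the triangle with vertices
`(-1,-1)`, `(n,0)`, `(0,1)`. -/
def omega (n : ℕ) (u : ℤ × ℤ) : ℚ :=
  (u.1 : ℚ) / n + u.2 + ((2 * n + 1 : ℚ) / n) * mMax u

/-- The non-negative integer `n ω(a,b)`, see `natCast_wt`. -/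
def wt (n : ℕ) (u : ℤ × ℤ) : ℕ := (u.1 + n * u.2 + (2 * n + 1) * mMax u).toNat

theorem natCast_wt (n : ℕ) (hn : 0 < n) (u : ℤ × ℤ) : (wt n u : ℚ) = n * omega n u := by
  have h0 : 0 ≤ u.1 + n * u.2 + (2 * n + 1) * mMax u := by
    have hn' : (0 : ℤ) ≤ n := by positivity
    have h1 : 0 ≤ mMax u := le_max_left _ _
    have h2 : -u.1 ≤ mMax u := le_trans (le_max_left _ _) (le_max_right _ _)
    have h3 : -u.2 ≤ mMax u := le_trans (le_max_right _ _) (le_max_right _ _)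
    nlinarith [mul_nonneg hn' (by linarith : 0 ≤ u.2 + mMax u), mul_nonneg hn' h1]
  have h : ((wt n u : ℤ) : ℚ) = ((u.1 + n * u.2 + (2 * n + 1) * mMax u : ℤ) : ℚ) := by
    rw [wt, Int.toNat_of_nonneg h0]
  have hn' : (n : ℚ) ≠ 0 := by positivity
  rw [Int.cast_natCast] at h
  rw [h, omega]
  push_cast
  field_simp

/-! ### The coefficient rings -/

section Rings

variable (p : ℕ) [Fact p.Prime] (a : ℕ)

/-- `ℚ_q`, `q = p ^ a`: the unramified extension of `ℚ_p` of degree `a` inside `ℂ_p`, generated by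
the `(q-1)`-st roots of unity. -/
def Qq : IntermediateField ℚ_[p] ℂ_[p] :=
  IntermediateField.adjoin ℚ_[p] {z : ℂ_[p] | z ^ (p ^ a - 1) = 1}

/-- `ℤ_q`: the ring of integers of `ℚ_q`, i.e. its elements of norm at most `1`. -/
def Zq : ValuationSubring (Qq p a) :=
  (NormedField.valuation (K := ℂ_[p])).valuationSubring.comap (algebraMap (Qq p a) ℂ_[p])

/-- `𝔽_q`: the residue field of `ℤ_q`. -/
abbrev Fq : Type := IsLocalRing.ResidueField (Zq p a)

/-- `s` is the Teichmüller lift of `t ∈ 𝔽_q`: it reduces to `t` and `s ^ q = s`. -/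
def IsTeichmuller (t : Fq p a) (s : Zq p a) : Prop :=
  IsLocalRing.residue (Zq p a) s = t ∧ s ^ (p ^ a) = s

/-- The ring `ℤ_q[g]` for `g ∈ ℂ_p`. -/
def ZqAdjoin (g : ℂ_[p]) : Subring ℂ_[p] := (Algebra.adjoin (Zq p a) {g}).toSubring

end Rings

/-! ### The space `C₀`

A formal series `∑ c(a,b) x^a y^b` is represented by its coefficient family `c : ℤ × ℤ → ℂ_p`. -/

section Space

variable (p : ℕ) [Fact p.Prime] (a n : ℕ)

/-- `C₀`: the series `∑ ξ(u) g^{n ω(u)} x^{u.1} y^{u.2}` with `ξ(u) ∈ ℤ_q[g]` and `|ξ(u)| → 0` as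
`ω(u) → ∞`. -/
def C0 (g : ℂ_[p]) : Submodule (ZqAdjoin p a g) (ℤ × ℤ → ℂ_[p]) where
  carrier := {c | ∃ ξ : ℤ × ℤ → ZqAdjoin p a g,
    Tendsto (fun u => ‖(ξ u : ℂ_[p])‖) (comap (omega n) atTop) (𝓝 0) ∧
    ∀ u, c u = (ξ u : ℂ_[p]) * g ^ wt n u}
  zero_mem' := ⟨0, by simpa using tendsto_const_nhds, by simp⟩
  add_mem' := by
    rintro c d ⟨ξ, hξ, hc⟩ ⟨η, hη, hd⟩
    refine ⟨ξ + η, ?_, fun u => ?_⟩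
    · refine squeeze_zero (fun u => norm_nonneg _) (fun u => ?_) (by simpa using hξ.add hη)
      exact norm_add_le _ _
    · simp [hc, hd, add_mul]
  smul_mem' := by
    rintro r c ⟨ξ, hξ, hc⟩
    refine ⟨fun u => r * ξ u, ?_, fun u => ?_⟩
    · have := hξ.const_mul ‖(r : ℂ_[p])‖
      simpa using this
    · simp [hc, mul_assoc, Subring.smul_def]

theorem monomial_mem_C0 (g : ℂ_[p]) (u : ℤ × ℤ) :
    (Pi.single u (g ^ wt n u) : ℤ × ℤ → ℂ_[p]) ∈ C0 p a n g := by
  refine ⟨Pi.single u 1, ?_, fun v => ?_⟩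
  · refine tendsto_const_nhds.congr' ?_
    have h : ∀ᶠ v in comap (omega n) atTop, omega n u < omega n v :=
      tendsto_comap.eventually (eventually_gt_atTop (omega n u))
    filter_upwards [h] with v hv
    have hvu : v ≠ u := by rintro rfl; exact lt_irrefl _ hv
    simp [Pi.single_eq_of_ne hvu]
  · by_cases hvu : v = u
    · subst hvu; simp
    · simp [Pi.single_eq_of_ne hvu]

/-- The exponent of `ε_i`: `x^i` for `0 ≤ i ≤ n` and `x^{i-n} y` for `n + 1 ≤ i ≤ 2n`. -/
def epsExp (i : ℕ) : ℤ × ℤ := if i ≤ n then ((i : ℤ), 0) else ((i : ℤ) - n, 1)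

/-- `ε̃_i = g^{n ω(ε_i)} ε_i ∈ C₀`, for `0 ≤ i ≤ 2n`. -/
def epsTilde (g : ℂ_[p]) (i : Fin (2 * n + 1)) : C0 p a n g :=
  ⟨Pi.single (epsExp n i) (g ^ wt n (epsExp n i)), monomial_mem_C0 p a n g _⟩

end Space

/-! ### The differential operators -/

section Operators

variable (p : ℕ) [Fact p.Prime] (n : ℕ)

/-- `γ_i = ∑_{k=0}^{i} γ^{p^k} / p^k`. -/
def gammaSeq (γ : ℂ_[p]) (i : ℕ) : ℂ_[p] :=
  ∑ k ∈ Finset.range (i + 1), γ ^ p ^ k / (p : ℂ_[p]) ^ k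

/-- `D_x = x ∂/∂x + ∑_i γ_i p^i (n x^{n p^i} - s^{p^i} / (x^{p^i} y^{p^i}))`, coefficientwise. Here
`s` is a Teichmüller lift, so that `s^{p^i}` is its image under the `i`-th power of Frobenius. -/
def Dx (γ s : ℂ_[p]) (c : ℤ × ℤ → ℂ_[p]) : ℤ × ℤ → ℂ_[p] := fun u =>
  (u.1 : ℂ_[p]) * c u + ∑' i : ℕ, gammaSeq p γ i * (p : ℂ_[p]) ^ i *
    ((n : ℂ_[p]) * c (u - ((n * p ^ i : ℤ), (0 : ℤ)))
      - s ^ p ^ i * c (u - (-(p ^ i : ℤ), -(p ^ i : ℤ))))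

/-- `D_y = y ∂/∂y + ∑_i γ_i p^i (y^{p^i} - s^{p^i} / (x^{p^i} y^{p^i}))`, coefficientwise. -/
def Dy (γ s : ℂ_[p]) (c : ℤ × ℤ → ℂ_[p]) : ℤ × ℤ → ℂ_[p] := fun u =>
  (u.2 : ℂ_[p]) * c u + ∑' i : ℕ, gammaSeq p γ i * (p : ℂ_[p]) ^ i *
    (c (u - ((0 : ℤ), (p ^ i : ℤ)))
      - s ^ p ^ i * c (u - (-(p ^ i : ℤ), -(p ^ i : ℤ))))

end Operators

/-! ### The complex `M → M dx/x ⊕ M dy/y → M dx/x ∧ dy/y` -/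

section Complex

variable {R M : Type*} [CommRing R] [AddCommGroup M] [Module R M] (δx δy : M →ₗ[R] M)

/-- `ξ ↦ δx(ξ) dx/x + δy(ξ) dy/y`. -/
def d0 : M →ₗ[R] M × M := δx.prod δy

/-- `ξ₁ dx/x + ξ₂ dy/y ↦ (δx(ξ₂) - δy(ξ₁)) dx/x ∧ dy/y`. -/
def d1 : M × M →ₗ[R] M := δx ∘ₗ LinearMap.snd R M M - δy ∘ₗ LinearMap.fst R M M

/-- The top cohomology: everything in degree two is a cocycle. -/
abbrev H2 : Type _ := M ⧸ LinearMap.range (d1 δx δy)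

end Complex

end DworkCohomology

end

open DworkCohomology

/-!
Write `g = γ̃`. Modulo `g`, the product of two weight-normalized monomials vanishes unless their
exponents lie in a common cone of the fan spanned by the exponents of `x`, `y` and
`z = 1 / (x y)`. So `C₀` reduces to `k[x, y, z] / (x y z)`, where `D_x` and `D_y` become logarithmic
derivations twisted by their symbols `n x^n - t z` and `y - t z`; the terms with `i > 0`
disappear, since `γ_i p^i` is divisible by `g^(n p^i + i)`. Together with `x y z` the symbols
form a regular sequence, with the `ε_i` as a basis of the quotient. Comparing top weights, the
same holds for the twisted derivations: the `ε_i` span the cokernel, and every relation among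
them and the values of the two operators is trivial. Both facts lift from the reduction to `C₀`,
which is complete and separated for the powers of `g`.
-/

noncomputable section

namespace DworkCohomology

/-! ### Linear operators in two variables -/

section TotalMap

variable {R M ι : Type*} [CommRing R] [AddCommGroup M] [Module R M] [Fintype ι]

/-- The operator `(r, ξ, η) ↦ ∑ r(i) e(i) + δx ξ + δy η`, whose surjectivity and kernel express that
the classes of the `e(i)` are a basis of `M / (δx M + δy M)`. -/
def totalMap (e : ι → M) (δx δy : M →ₗ[R] M) : (ι → R) × M × M →ₗ[R] M :=
  (Fintype.linearCombination R e).coprod (δx.coprod δy)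

theorem totalMap_apply (e : ι → M) (δx δy : M →ₗ[R] M) (x : (ι → R) × M × M) :
    totalMap e δx δy x = ∑ i, x.1 i • e i + (δx x.2.1 + δy x.2.2) := rfl

end TotalMap

/-! ### The reduction of the complex modulo `g` -/

section Graded

open MvPolynomial

section Euler

variable {k σ : Type*} [CommRing k]

theorem monomial_one_dvd_iff {s : σ →₀ ℕ} {q : MvPolynomial σ k} :
    monomial s 1 ∣ q ↔ ∀ d, ¬ s ≤ d → coeff d q = 0 := by
  rw [monomial_one_dvd_iff_modMonomial_eq_zero, MvPolynomial.ext_iff]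
  refine forall_congr' fun d => ?_
  by_cases hd : s ≤ d
  · simp [hd, coeff_modMonomial_of_le]
  · simp [hd, coeff_modMonomial_of_not_le]

/-- The derivation `∑ c(i) X(i) ∂/∂X(i)`. -/
def eulerDer (c : σ → k) : Derivation k (MvPolynomial σ k) (MvPolynomial σ k) :=
  mkDerivation k fun i => c i • X i

theorem eulerDer_monomial (c : σ → k) (d : σ →₀ ℕ) (r : k) :
    eulerDer c (monomial d r) = Finsupp.weight c d • monomial d r := by
  rw [eulerDer, mkDerivation_monomial, Finsupp.weight_apply, Finsupp.sum, Finsupp.sum,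
    Finset.smul_sum, Finset.sum_smul]
  refine Finset.sum_congr rfl fun i hi => ?_
  have hle : Finsupp.single i 1 ≤ d :=
    Finsupp.single_le_iff.2 (Nat.one_le_iff_ne_zero.2 (Finsupp.mem_support_iff.1 hi))
  rw [smul_eq_mul, mul_smul_comm, X, monomial_mul, tsub_add_cancel_of_le hle, smul_monomial,
    smul_monomial, smul_monomial]
  simp only [smul_eq_mul, nsmul_eq_mul, mul_one]
  congr 1
  ring

theorem coeff_eulerDer (c : σ → k) (d : σ →₀ ℕ) (q : MvPolynomial σ k) :
    coeff d (eulerDer c q) = Finsupp.weight c d * coeff d q := by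
  classical
  induction q using MvPolynomial.induction_on' with
  | monomial e r =>
    rw [eulerDer_monomial, coeff_smul, coeff_monomial, smul_eq_mul]
    split_ifs with h
    · rw [h]
    · simp only [mul_zero]
  | add q r hq hr => rw [map_add, coeff_add, coeff_add, hq, hr, mul_add]

theorem eulerDer_comm (c c' : σ → k) (q : MvPolynomial σ k) :
    eulerDer c (eulerDer c' q) = eulerDer c' (eulerDer c q) := by
  ext d
  simp only [coeff_eulerDer, mul_left_comm]

/-- The operator `∑ c(i) X(i) ∂/∂X(i) + φ`. -/
def twistedDer (c : σ → k) (φ : MvPolynomial σ k) : MvPolynomial σ k →ₗ[k] MvPolynomial σ k :=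
  (eulerDer c : MvPolynomial σ k →ₗ[k] MvPolynomial σ k) + LinearMap.mulLeft k φ

theorem twistedDer_apply (c : σ → k) (φ q : MvPolynomial σ k) :
    twistedDer c φ q = eulerDer c q + φ * q := rfl

theorem twistedDer_comm {c c' : σ → k} {φ φ' : MvPolynomial σ k}
    (h : eulerDer c φ' = eulerDer c' φ) (q : MvPolynomial σ k) :
    twistedDer c φ (twistedDer c' φ' q) = twistedDer c' φ' (twistedDer c φ q) := by
  simp only [twistedDer_apply, map_add, Derivation.leibniz, smul_eq_mul, h, eulerDer_comm c c']
  ring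

theorem monomial_one_dvd_twistedDer {s : σ →₀ ℕ} {q : MvPolynomial σ k} (h : monomial s 1 ∣ q)
    (c : σ → k) (φ : MvPolynomial σ k) : monomial s 1 ∣ twistedDer c φ q := by
  refine dvd_add (monomial_one_dvd_iff.2 fun d hd => ?_) (h.mul_left φ)
  rw [Derivation.coeFn_coe, coeff_eulerDer, monomial_one_dvd_iff.1 h d hd, mul_zero]

theorem monomial_one_dvd_weightedHomogeneousComponent {s : σ →₀ ℕ} {q : MvPolynomial σ k}
    (h : monomial s 1 ∣ q) (w : σ → ℕ) (m : ℕ) :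
    monomial s 1 ∣ weightedHomogeneousComponent w m q := by
  refine monomial_one_dvd_iff.2 fun d hd => ?_
  rw [coeff_weightedHomogeneousComponent, monomial_one_dvd_iff.1 h d hd, ite_self]

theorem weightedHomogeneousComponent_mul {w : σ → ℕ} {φ : MvPolynomial σ k} {e : ℕ}
    (hφ : IsWeightedHomogeneous w φ e) (m : ℕ) (q : MvPolynomial σ k) :
    weightedHomogeneousComponent w m (φ * q)
      = φ * if e ≤ m then weightedHomogeneousComponent w (m - e) q else 0 := by
  let _ := weightedGradedAlgebra k w
  have h := DirectSum.coe_decompose_mul_of_left_mem (weightedHomogeneousSubmodule k w) m (b := q)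
    ((mem_weightedHomogeneousSubmodule k w e φ).2 hφ)
  have hdec (q : MvPolynomial σ k) (m : ℕ) :
      (DirectSum.decompose (weightedHomogeneousSubmodule k w) q m : MvPolynomial σ k)
        = weightedHomogeneousComponent w m q := weightedDecomposition.decompose'_apply k w q m
  rw [mul_ite, mul_zero, ← hdec, ← hdec, h]

/-- The polynomials all of whose monomials have weight less than `m`. -/
def weightLT (k : Type*) [CommRing k] (w : σ → ℕ) (m : ℕ) : Submodule k (MvPolynomial σ k) :=
  restrictSupport k {d | Finsupp.weight w d < m}

theorem mem_weightLT {w : σ → ℕ} {m : ℕ} {q : MvPolynomial σ k} :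
    q ∈ weightLT k w m ↔ ∀ d, m ≤ Finsupp.weight w d → coeff d q = 0 := by
  rw [weightLT, mem_restrictSupport_iff]
  refine forall_congr' fun d => ?_
  rw [Finset.mem_coe, mem_support_iff, Set.mem_ofPred_eq, ← not_le]
  exact not_imp_not

theorem weightLT_mono (w : σ → ℕ) : Monotone (weightLT k w) :=
  fun _ _ h => restrictSupport_mono _ fun _ hd => lt_of_lt_of_le hd h

theorem exists_mem_weightLT (w : σ → ℕ) (q : MvPolynomial σ k) : ∃ m, q ∈ weightLT k w m :=
  ⟨weightedTotalDegree w q + 1, fun _ hd => Nat.lt_succ_of_le (le_weightedTotalDegree w hd)⟩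

theorem mem_weightLT_zero {w : σ → ℕ} {q : MvPolynomial σ k} : q ∈ weightLT k w 0 ↔ q = 0 := by
  simp [mem_weightLT, MvPolynomial.ext_iff]

theorem eulerDer_mem_weightLT {w : σ → ℕ} {m : ℕ} {q : MvPolynomial σ k}
    (hq : q ∈ weightLT k w m) (c : σ → k) : eulerDer c q ∈ weightLT k w m :=
  mem_weightLT.2 fun d hd => by rw [coeff_eulerDer, mem_weightLT.1 hq d hd, mul_zero]

theorem weightedHomogeneousComponent_mem_weightLT (w : σ → ℕ) {m m' : ℕ} (h : m < m')
    (q : MvPolynomial σ k) : weightedHomogeneousComponent w m q ∈ weightLT k w m' :=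
  mem_weightLT.2 fun d hd => by rw [coeff_weightedHomogeneousComponent, if_neg (by omega)]

theorem weightedHomogeneousComponent_eq_zero_of_mem_weightLT {w : σ → ℕ} {m m' : ℕ}
    {q : MvPolynomial σ k} (hq : q ∈ weightLT k w m) (h : m ≤ m') :
    weightedHomogeneousComponent w m' q = 0 := by
  ext d
  rw [coeff_weightedHomogeneousComponent, coeff_zero, ite_eq_right_iff]
  exact fun hd => mem_weightLT.1 hq d (by omega)

theorem sub_weightedHomogeneousComponent_mem_weightLT {w : σ → ℕ} {m : ℕ}
    {q : MvPolynomial σ k} (hq : q ∈ weightLT k w (m + 1)) :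
    q - weightedHomogeneousComponent w m q ∈ weightLT k w m := by
  refine mem_weightLT.2 fun d hd => ?_
  rw [coeff_sub, coeff_weightedHomogeneousComponent]
  split_ifs with h
  · rw [sub_self]
  · rw [mem_weightLT.1 hq d (by omega), sub_zero]

theorem weightedHomogeneousComponent_twistedDer {w : σ → ℕ} {φ : MvPolynomial σ k} {e m : ℕ}
    (hφ : IsWeightedHomogeneous w φ e) (he : 0 < e) (c : σ → k) {q : MvPolynomial σ k}
    (hq : q ∈ weightLT k w (m + 1)) :
    weightedHomogeneousComponent w (m + e) (twistedDer c φ q)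
      = φ * weightedHomogeneousComponent w m q := by
  rw [twistedDer_apply, map_add, weightedHomogeneousComponent_eq_zero_of_mem_weightLT
    (eulerDer_mem_weightLT hq c) (by omega), zero_add, weightedHomogeneousComponent_mul hφ,
    if_pos (Nat.le_add_left e m), Nat.add_sub_cancel]

theorem weightedHomogeneousComponent_self (w : σ → ℕ) (m : ℕ) (q : MvPolynomial σ k) :
    weightedHomogeneousComponent w m (weightedHomogeneousComponent w m q)
      = weightedHomogeneousComponent w m q :=
  (weightedHomogeneousComponent_isWeightedHomogeneous m q).weightedHomogeneousComponent_same

theorem mem_of_algHom_eq_zero {B : Type*} [CommRing B] [Algebra k B]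
    {J : Ideal (MvPolynomial σ k)} (φ : MvPolynomial σ k →ₐ[k] B) (ψ : B →ₐ[k] MvPolynomial σ k)
    (h : ∀ i, X i - ψ (φ (X i)) ∈ J) {q : MvPolynomial σ k} (hq : φ q = 0) : q ∈ J := by
  have hcomp : Ideal.Quotient.mkₐ k J = ((Ideal.Quotient.mkₐ k J).comp ψ).comp φ :=
    algHom_ext fun i => Ideal.Quotient.mk_eq_mk_iff_sub_mem _ _ |>.2 (h i)
  refine Ideal.Quotient.eq_zero_iff_mem.1 (?_ : Ideal.Quotient.mkₐ k J q = 0)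
  rw [hcomp, AlgHom.comp_apply, hq, map_zero]

end Euler

section ThreeVariables

variable {k : Type*} [CommRing k]

/-- The exponent of the monomial `x ^ A * y ^ j * z ^ l`. -/
def expo (A j l : ℕ) : Fin 3 →₀ ℕ :=
  Finsupp.single 0 A + Finsupp.single 1 j + Finsupp.single 2 l

@[simp] theorem expo_zero (A j l : ℕ) : expo A j l 0 = A := by simp [expo]

@[simp] theorem expo_one (A j l : ℕ) : expo A j l 1 = j := by simp [expo]

@[simp] theorem expo_two (A j l : ℕ) : expo A j l 2 = l := by simp [expo]

theorem finsupp_fin_three_ext {d e : Fin 3 →₀ ℕ} (h0 : d 0 = e 0) (h1 : d 1 = e 1)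
    (h2 : d 2 = e 2) : d = e := by
  ext i
  fin_cases i <;> assumption

theorem eq_expo (d : Fin 3 →₀ ℕ) : d = expo (d 0) (d 1) (d 2) :=
  finsupp_fin_three_ext (by simp) (by simp) (by simp)

theorem expo_add_expo (A j l A' j' l' : ℕ) :
    expo A j l + expo A' j' l' = expo (A + A') (j + j') (l + l') :=
  finsupp_fin_three_ext (by simp) (by simp) (by simp)

theorem weight_expo {S : Type*} [CommSemiring S] (a b c : S) (A j l : ℕ) :
    Finsupp.weight ![a, b, c] (expo A j l) = A * a + j * b + l * c := by
  simp [Finsupp.weight_apply, Finsupp.sum_fintype, Fin.sum_univ_three]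

theorem monomial_expo (A j l : ℕ) (r : k) :
    monomial (expo A j l) r = C r * X 0 ^ A * X 1 ^ j * X 2 ^ l := by
  rw [monomial_eq, Finsupp.prod_fintype _ _ fun _ => pow_zero _, Fin.prod_univ_three]
  simp only [expo_zero, expo_one, expo_two, mul_assoc]

/-- The monomial `x y z`. In the reduction of `C₀` modulo `g`, the variables `x`, `y` and `z` are
the classes of `g x`, `g ^ n y` and `g ^ n x⁻¹ y⁻¹`, and their product vanishes. -/
def xyz (k : Type*) [CommRing k] : MvPolynomial (Fin 3) k := monomial (expo 1 1 1) 1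

/-- The weights of `x`, `y` and `z`. -/
def varWt (n : ℕ) : Fin 3 → ℕ := ![1, n, n]

/-- The symbol `n x ^ n - t z` of `D_x`. -/
def symbX (n : ℕ) (t : k) : MvPolynomial (Fin 3) k :=
  monomial (expo n 0 0) (n : k) - monomial (expo 0 0 1) t

/-- The symbol `y - t z` of `D_y`. -/
def symbY (t : k) : MvPolynomial (Fin 3) k := monomial (expo 0 1 0) 1 - monomial (expo 0 0 1) t

/-- The reduction of `D_x` modulo `g`. -/
def redDx (n : ℕ) (t : k) : MvPolynomial (Fin 3) k →ₗ[k] MvPolynomial (Fin 3) k :=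
  twistedDer ![1, 0, -1] (symbX n t)

/-- The reduction of `D_y` modulo `g`. -/
def redDy (t : k) : MvPolynomial (Fin 3) k →ₗ[k] MvPolynomial (Fin 3) k :=
  twistedDer ![0, 1, -1] (symbY t)

/-- The exponent of the reduction of `ε̃_i`: `x ^ i` for `i ≤ n` and `x ^ (i - n) * y` for
`n < i`. -/
def basisExpo (n i : ℕ) : Fin 3 →₀ ℕ := if i ≤ n then expo i 0 0 else expo (i - n) 1 0

/-- The reductions of the `ε̃_i`. -/
def basisMonomial (k : Type*) [CommRing k] (n : ℕ) (i : Fin (2 * n + 1)) :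
    MvPolynomial (Fin 3) k :=
  monomial (basisExpo n i) 1

theorem symbX_eq (n : ℕ) (t : k) : symbX n t = C (n : k) * X 0 ^ n - C t * X 2 := by
  simp [symbX, monomial_expo]

theorem symbY_eq (t : k) : symbY t = X 1 - C t * X 2 := by
  simp [symbY, monomial_expo]

theorem redDx_comm_redDy (n : ℕ) (t : k) (q : MvPolynomial (Fin 3) k) :
    redDx n t (redDy t q) = redDy t (redDx n t q) := by
  refine twistedDer_comm ?_ q
  simp [symbX, symbY, eulerDer_monomial, weight_expo]

theorem xyz_dvd_monomial_expo (A j l : ℕ) (r : k) :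
    xyz k ∣ monomial (expo (A + 1) (j + 1) (l + 1)) r :=
  ⟨monomial (expo A j l) r, by rw [xyz, monomial_mul, expo_add_expo, one_mul]; ac_rfl⟩

theorem weight_varWt_expo (n A j l : ℕ) :
    Finsupp.weight (varWt n) (expo A j l) = A + n * (j + l) := by
  simp only [varWt, weight_expo, Nat.cast_id]
  ring

theorem mem_iff_of_smul_sub_smul_mem {M : Type*} [AddCommGroup M] [Module k M]
    {S : Submodule k M} {r s : k} (hr : IsUnit r) (hs : IsUnit s) {u v : M}
    (h : r • u - s • v ∈ S) : u ∈ S ↔ v ∈ S := by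
  rw [← S.smul_mem_iff_of_isUnit hr (x := u), ← S.smul_mem_iff_of_isUnit hs (x := v)]
  exact ⟨fun hu => by simpa only [sub_sub_cancel] using S.sub_mem hu h,
    fun hv => by simpa only [sub_add_cancel] using S.add_mem h hv⟩

/-- The polynomials that are modulo `x y z` a combination of the `ε_i` and of values of the
reductions of `D_x` and `D_y`. -/
def redSpan (n : ℕ) (t : k) : Submodule k (MvPolynomial (Fin 3) k) :=
  LinearMap.range (totalMap (basisMonomial k n) (redDx n t) (redDy t))
    ⊔ (Ideal.span {xyz k}).restrictScalars k

theorem mem_redSpan {n : ℕ} {t : k} {q : MvPolynomial (Fin 3) k} :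
    q ∈ redSpan n t ↔
      ∃ x, xyz k ∣ q - totalMap (basisMonomial k n) (redDx n t) (redDy t) x := by
  rw [redSpan, Submodule.mem_sup]
  constructor
  · rintro ⟨_, ⟨x, rfl⟩, r, hr, rfl⟩
    exact ⟨x, by rw [add_sub_cancel_left]; exact Ideal.mem_span_singleton.1 hr⟩
  · rintro ⟨x, hx⟩
    exact ⟨_, ⟨x, rfl⟩, _, Ideal.mem_span_singleton.2 hx, add_sub_cancel _ _⟩

theorem basisMonomial_mem_redSpan (n : ℕ) (t : k) {i : ℕ} (hi : i ≤ 2 * n) :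
    monomial (basisExpo n i) 1 ∈ redSpan n t := by
  refine mem_redSpan.2 ⟨(Pi.single ⟨i, Nat.lt_succ_of_le hi⟩ 1, 0, 0), ?_⟩
  simp [totalMap, basisMonomial, Fintype.linearCombination_apply_single]

theorem redDx_mem_redSpan (n : ℕ) (t : k) (q : MvPolynomial (Fin 3) k) :
    redDx n t q ∈ redSpan n t :=
  mem_redSpan.2 ⟨(0, q, 0), by simp [totalMap_apply]⟩

theorem redDy_mem_redSpan (n : ℕ) (t : k) (q : MvPolynomial (Fin 3) k) :
    redDy t q ∈ redSpan n t :=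
  mem_redSpan.2 ⟨(0, 0, q), by simp [totalMap_apply]⟩

theorem mem_redSpan_of_xyz_dvd (n : ℕ) (t : k) {q : MvPolynomial (Fin 3) k} (h : xyz k ∣ q) :
    q ∈ redSpan n t :=
  mem_redSpan.2 ⟨0, by simpa using h⟩

theorem monomial_mem_redSpan_iff_of_symbX {n : ℕ} {t : k} (hnk : IsUnit (n : k)) (ht : IsUnit t)
    {A j l : ℕ} (h : monomial (expo A j l) 1 ∈ redSpan n t) :
    monomial (expo (A + n) j l) 1 ∈ redSpan n t ↔
      monomial (expo A j (l + 1)) 1 ∈ redSpan n t := by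
  refine mem_iff_of_smul_sub_smul_mem hnk ht ?_
  have hD := redDx_mem_redSpan n t (monomial (expo A j l) 1)
  rw [redDx, twistedDer_apply, eulerDer_monomial,
    Submodule.add_mem_iff_right _ (Submodule.smul_mem _ _ h)] at hD
  simpa [symbX, sub_mul, monomial_mul, expo_add_expo, smul_monomial, add_comm] using hD

theorem monomial_mem_redSpan_iff_of_symbY {n : ℕ} {t : k} (ht : IsUnit t)
    {A j l : ℕ} (h : monomial (expo A j l) 1 ∈ redSpan n t) :
    monomial (expo A (j + 1) l) 1 ∈ redSpan n t ↔
      monomial (expo A j (l + 1)) 1 ∈ redSpan n t := by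
  refine mem_iff_of_smul_sub_smul_mem isUnit_one ht ?_
  have hD := redDy_mem_redSpan n t (monomial (expo A j l) 1)
  rw [redDy, twistedDer_apply, eulerDer_monomial,
    Submodule.add_mem_iff_right _ (Submodule.smul_mem _ _ h)] at hD
  simpa [symbY, sub_mul, monomial_mul, expo_add_expo, smul_monomial, add_comm] using hD

theorem monomial_mem_redSpan_iff_pow {n : ℕ} {t : k} (hnk : IsUnit (n : k)) (ht : IsUnit t)
    {w : ℕ} (hlow : ∀ A j l, A + n * (j + l) < w → monomial (expo A j l) 1 ∈ redSpan n t)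
    (hn : 0 < n) (A j l : ℕ) (hw : A + n * (j + l) = w) :
    monomial (expo A j l) 1 ∈ redSpan n t ↔ monomial (expo w 0 0) 1 ∈ redSpan n t := by
  induction l generalizing A j with
  | succ l ih =>
    rw [← monomial_mem_redSpan_iff_of_symbX hnk ht (hlow A j l (by lia)), ih _ _ (by lia)]
  | zero =>
    induction j generalizing A with
    | succ j ih =>
      have h := hlow A j 0 (by lia)
      rw [monomial_mem_redSpan_iff_of_symbY ht h, ← monomial_mem_redSpan_iff_of_symbX hnk ht h,
        ih _ (by lia)]
    | zero => rw [← hw, add_zero, mul_zero, add_zero]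

theorem monomial_mem_redSpan {n : ℕ} (hn : 0 < n) {t : k} (hnk : IsUnit (n : k)) (ht : IsUnit t)
    (A j l : ℕ) : monomial (expo A j l) 1 ∈ redSpan n t := by
  obtain ⟨w, hw⟩ : ∃ w, A + n * (j + l) = w := ⟨_, rfl⟩
  induction w using Nat.strong_induction_on generalizing A j l with
  | _ w ih =>
  have hpow := monomial_mem_redSpan_iff_pow hnk ht (fun A j l h => ih _ h A j l rfl) hn
  rw [hpow A j l hw]
  rcases le_or_gt w n with hwn | hnw
  · simpa [basisExpo, hwn] using basisMonomial_mem_redSpan n t (i := w) (by omega)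
  rcases le_or_gt w (2 * n) with hw2 | hw2
  · rw [← hpow (w - n) 1 0 (by lia)]
    simpa [basisExpo, hnw.not_ge] using basisMonomial_mem_redSpan n t hw2
  · obtain ⟨B, rfl⟩ := Nat.exists_eq_add_of_lt hw2
    rw [← hpow (B + 1) 1 1 (by lia)]
    exact mem_redSpan_of_xyz_dvd n t (xyz_dvd_monomial_expo B 0 0 1)

theorem exists_xyz_dvd_sub_totalMap {n : ℕ} (hn : 0 < n) {t : k} (hnk : IsUnit (n : k))
    (ht : IsUnit t) (q : MvPolynomial (Fin 3) k) :
    ∃ x, xyz k ∣ q - totalMap (basisMonomial k n) (redDx n t) (redDy t) x := by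
  refine mem_redSpan.1 ?_
  induction q using MvPolynomial.induction_on' with
  | monomial d r =>
    have h := Submodule.smul_mem _ r (monomial_mem_redSpan hn hnk ht (d 0) (d 1) (d 2))
    rwa [smul_monomial, smul_eq_mul, mul_one, ← eq_expo] at h
  | add q r hq hr => exact Submodule.add_mem _ hq hr

/-- The substitution `y = n x ^ n`, `z = n s x ^ n`, which kills both symbols when `t * s = 1`. -/
def substX (n : ℕ) (s : k) : MvPolynomial (Fin 3) k →ₐ[k] Polynomial k :=
  aeval ![.X, .C (n : k) * .X ^ n, .C (n * s) * .X ^ n]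

/-- The substitution `y = t z`, which kills the symbol of `D_y`. -/
def substY (t : k) : MvPolynomial (Fin 3) k →ₐ[k] MvPolynomial (Fin 3) k :=
  aeval ![X 0, C t * X 2, X 2]

theorem substX_monomial (n : ℕ) (s : k) (A j l : ℕ) (r : k) :
    substX n s (monomial (expo A j l) r)
      = Polynomial.monomial (A + n * (j + l)) (r * n ^ j * (n * s) ^ l) := by
  simp only [substX, monomial_expo, map_mul, map_pow, aeval_X, aeval_C,
    ← Polynomial.C_mul_X_pow_eq_monomial, Matrix.cons_val, Polynomial.algebraMap_eq]
  ring

theorem substX_symbX (n : ℕ) {t s : k} (hs : t * s = 1) : substX n s (symbX n t) = 0 := by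
  rw [symbX, map_sub, substX_monomial, substX_monomial, sub_eq_zero]
  simp [mul_left_comm t, hs]

theorem substX_symbY (n : ℕ) {t s : k} (hs : t * s = 1) : substX n s (symbY t) = 0 := by
  rw [symbY, map_sub, substX_monomial, substX_monomial, sub_eq_zero]
  simp [mul_left_comm t, hs]

theorem exists_eq_symb_of_substX_eq_zero (n : ℕ) {t s : k} (hs : t * s = 1)
    {q : MvPolynomial (Fin 3) k} (hq : substX n s q = 0) :
    ∃ α β, q = symbX n t * α + symbY t * β := by
  suffices h : q ∈ Ideal.span {symbX n t, symbY t} by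
    obtain ⟨α, β, hαβ⟩ := Ideal.mem_span_pair.1 h
    exact ⟨α, β, by rw [← hαβ]; ring⟩
  have hC : (C t * C s : MvPolynomial (Fin 3) k) = 1 := by rw [← C_mul, hs, C_1]
  refine mem_of_algHom_eq_zero (substX n s) (Polynomial.aeval (X 0)) (fun i => ?_) hq
  rw [Ideal.mem_span_pair, substX, aeval_X]
  fin_cases i
  · exact ⟨0, 0, by simp⟩
  · refine ⟨-1, 1, ?_⟩
    simp [symbX_eq, symbY_eq]
  · refine ⟨- C s, 0, ?_⟩
    simp only [Fin.reduceFinMk, Matrix.cons_val, map_mul, map_pow, Polynomial.aeval_C,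
      Polynomial.aeval_X, algebraMap_eq, symbX_eq, zero_mul, add_zero]
    linear_combination (X 2) * hC

theorem symbY_dvd_of_substY_eq_zero {t : k} {q : MvPolynomial (Fin 3) k}
    (hq : substY t q = 0) : symbY t ∣ q := by
  refine Ideal.mem_span_singleton.1 (mem_of_algHom_eq_zero (substY t) (.id k _) (fun i => ?_) hq)
  rw [Ideal.mem_span_singleton, substY, aeval_X]
  fin_cases i <;> simp [symbY_eq]

theorem symbX_ne_zero [Nontrivial k] {n : ℕ} (hnk : IsUnit (n : k)) (t : k) : symbX n t ≠ 0 :=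
  fun h => hnk.ne_zero (by simpa [symbX_eq] using congrArg (eval ![1, 0, 0]) h)

theorem symbY_ne_zero [Nontrivial k] (t : k) : symbY t ≠ 0 :=
  fun h => by simpa [symbY_eq] using congrArg (eval ![0, 1, 0]) h

theorem symb_koszul [IsDomain k] {n : ℕ} {t : k} (hnk : IsUnit (n : k))
    {ξ η : MvPolynomial (Fin 3) k} (h : symbX n t * ξ + symbY t * η = 0) :
    ∃ ζ, ξ = symbY t * ζ ∧ η = -(symbX n t * ζ) := by
  have hX : substY t (symbX n t) = symbX n t := by simp [substY, symbX_eq]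
  have hY : substY t (symbY t) = 0 := by simp [substY, symbY_eq]
  have hξ : substY t ξ = 0 := by
    have := congrArg (substY t) h
    rw [map_add, map_mul, map_mul, hX, hY, zero_mul, add_zero, map_zero] at this
    exact (mul_eq_zero.1 this).resolve_left (symbX_ne_zero hnk t)
  obtain ⟨ζ, rfl⟩ := symbY_dvd_of_substY_eq_zero hξ
  refine ⟨ζ, rfl, mul_left_cancel₀ (symbY_ne_zero t) ?_⟩
  linear_combination h

theorem symb_koszul_mod_xyz [IsDomain k] {n : ℕ} {t : k} (hnk : IsUnit (n : k)) (ht : IsUnit t)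
    {ξ η : MvPolynomial (Fin 3) k} (h : xyz k ∣ symbX n t * ξ + symbY t * η) :
    ∃ ζ, xyz k ∣ ξ - symbY t * ζ ∧ xyz k ∣ η + symbX n t * ζ := by
  obtain ⟨s, hs⟩ := ht.exists_right_inv
  obtain ⟨q, hq⟩ := h
  have hxyz : substX n s (xyz k) ≠ 0 := by
    rw [xyz, substX_monomial, Ne, Polynomial.monomial_eq_zero_iff]
    simp [hnk.ne_zero, right_ne_zero_of_mul_eq_one hs]
  have hq0 : substX n s q = 0 := by
    have := congrArg (substX n s) hq
    rw [map_add, map_mul, map_mul, map_mul, substX_symbX n hs, substX_symbY n hs, zero_mul,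
      zero_mul, add_zero, eq_comm] at this
    exact (mul_eq_zero.1 this).resolve_left hxyz
  obtain ⟨α, β, rfl⟩ := exists_eq_symb_of_substX_eq_zero n hs hq0
  obtain ⟨ζ, hξ, hη⟩ := symb_koszul (t := t) (ξ := ξ - xyz k * α) (η := η - xyz k * β) hnk
    (by linear_combination hq)
  exact ⟨ζ, ⟨α, by rw [← hξ]; ring⟩, ⟨β, by linear_combination hη⟩⟩

theorem substX_basisMonomial (n : ℕ) (s : k) (i : Fin (2 * n + 1)) :
    substX n s (basisMonomial k n i)
      = Polynomial.monomial (i : ℕ) (if (i : ℕ) ≤ n then 1 else (n : k)) := by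
  rw [basisMonomial, basisExpo]
  split_ifs with h
  · simp [substX_monomial]
  · simp [substX_monomial, Nat.sub_add_cancel (not_le.1 h).le]

theorem eq_zero_of_xyz_dvd_symb [IsDomain k] {n : ℕ} {t : k} (hnk : IsUnit (n : k))
    (ht : IsUnit t) {v : Fin (2 * n + 1) → k} {ξ η : MvPolynomial (Fin 3) k}
    (h : xyz k ∣ ∑ i, v i • basisMonomial k n i + (symbX n t * ξ + symbY t * η)) : v = 0 := by
  obtain ⟨s, hs⟩ := ht.exists_right_inv
  -- `substX` maps the basis monomials to degrees at most `2 n` and `x y z` to degree `2 n + 1`.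
  have hdvd : Polynomial.X ^ (2 * n + 1) ∣ ∑ i, v i • substX n s (basisMonomial k n i) := by
    have := map_dvd (substX n s) h
    rw [map_add, map_add, map_mul, map_mul, substX_symbX n hs, substX_symbY n hs, zero_mul,
      zero_mul, add_zero, add_zero, map_sum, xyz, substX_monomial,
      show 1 + n * (1 + 1) = 2 * n + 1 by ring, ← Polynomial.C_mul_X_pow_eq_monomial] at this
    simpa only [map_smul] using dvd_of_mul_left_dvd this
  funext i
  have hi := Polynomial.X_pow_dvd_iff.1 hdvd i i.2
  simp only [substX_basisMonomial, Polynomial.finsetSum_coeff, Polynomial.coeff_smul,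
    Polynomial.coeff_monomial, Fin.val_inj, smul_eq_mul, mul_ite, mul_zero, Finset.sum_ite_eq',
    Finset.mem_univ, if_true] at hi
  split_ifs at hi
  · simpa using hi
  · exact (mul_eq_zero.1 hi).resolve_right hnk.ne_zero

theorem symb_exact [IsDomain k] {n : ℕ} {t : k} (hnk : IsUnit (n : k)) (ht : IsUnit t)
    {v : Fin (2 * n + 1) → k} {ξ η : MvPolynomial (Fin 3) k}
    (h : xyz k ∣ ∑ i, v i • basisMonomial k n i + (symbX n t * ξ + symbY t * η)) :
    v = 0 ∧ ∃ ζ, xyz k ∣ ξ - symbY t * ζ ∧ xyz k ∣ η + symbX n t * ζ := by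
  obtain rfl := eq_zero_of_xyz_dvd_symb hnk ht h
  exact ⟨rfl, symb_koszul_mod_xyz hnk ht (by simpa using h)⟩

theorem symbX_isWeightedHomogeneous (n : ℕ) (t : k) :
    IsWeightedHomogeneous (varWt n) (symbX n t) n :=
  .sub (isWeightedHomogeneous_monomial _ _ _ (by simp [weight_varWt_expo]))
    (isWeightedHomogeneous_monomial _ _ _ (by simp [weight_varWt_expo]))

theorem symbY_isWeightedHomogeneous (n : ℕ) (t : k) :
    IsWeightedHomogeneous (varWt n) (symbY t) n :=
  .sub (isWeightedHomogeneous_monomial _ _ _ (by simp [weight_varWt_expo]))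
    (isWeightedHomogeneous_monomial _ _ _ (by simp [weight_varWt_expo]))

theorem basisMonomial_isWeightedHomogeneous (n : ℕ) (i : Fin (2 * n + 1)) :
    IsWeightedHomogeneous (varWt n) (basisMonomial k n i) i := by
  refine isWeightedHomogeneous_monomial _ _ _ ?_
  rw [basisExpo]
  split_ifs <;> simp [weight_varWt_expo]; omega

theorem weightedHomogeneousComponent_sum_basisMonomial (n m : ℕ) (v : Fin (2 * n + 1) → k) :
    weightedHomogeneousComponent (varWt n) m (∑ i, v i • basisMonomial k n i)
      = ∑ i : Fin (2 * n + 1), (if (i : ℕ) = m then v i else 0) • basisMonomial k n i := by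
  rw [map_sum]
  refine Finset.sum_congr rfl fun i _ => ?_
  rw [map_smul, ite_smul, zero_smul]
  split_ifs with h
  · rw [← h, (basisMonomial_isWeightedHomogeneous n i).weightedHomogeneousComponent_same]
  · rw [(basisMonomial_isWeightedHomogeneous n i).weightedHomogeneousComponent_ne _ (Ne.symm h),
      smul_zero]

/-- If `(v, ξ, η)` lies in the kernel modulo `x y z`, then so do its top weight components for the
symbols, whose Koszul exactness lowers the weight of `(ξ, η)`. -/
theorem exists_weightLT_of_xyz_dvd_totalMap [IsDomain k] {n : ℕ} (hn : 0 < n) {t : k}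
    (hnk : IsUnit (n : k)) (ht : IsUnit t) {m : ℕ} {v : Fin (2 * n + 1) → k}
    {ξ η : MvPolynomial (Fin 3) k} (hξ : ξ ∈ weightLT k (varWt n) (m + 1))
    (hη : η ∈ weightLT k (varWt n) (m + 1))
    (h : xyz k ∣ totalMap (basisMonomial k n) (redDx n t) (redDy t) (v, ξ, η)) :
    ∃ ζ, ∃ ξ' ∈ weightLT k (varWt n) m, ∃ η' ∈ weightLT k (varWt n) m,
      xyz k ∣ ξ - redDy t ζ - ξ' ∧ xyz k ∣ η + redDx n t ζ - η' := by
  have hX := symbX_isWeightedHomogeneous n t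
  have hY := symbY_isWeightedHomogeneous n t
  have htop := monomial_one_dvd_weightedHomogeneousComponent h (varWt n) (m + n)
  rw [totalMap_apply, map_add, map_add, redDx, redDy,
    weightedHomogeneousComponent_twistedDer hX hn _ hξ,
    weightedHomogeneousComponent_twistedDer hY hn _ hη,
    weightedHomogeneousComponent_sum_basisMonomial] at htop
  obtain ⟨-, ζ, hζξ, hζη⟩ := symb_exact hnk ht htop
  have hζξ' : xyz k ∣ _ :=
    monomial_one_dvd_weightedHomogeneousComponent hζξ (varWt n) m
  have hζη' : xyz k ∣ _ :=
    monomial_one_dvd_weightedHomogeneousComponent hζη (varWt n) m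
  rw [map_sub, weightedHomogeneousComponent_self, weightedHomogeneousComponent_mul hY] at hζξ'
  rw [map_add, weightedHomogeneousComponent_self, weightedHomogeneousComponent_mul hX] at hζη'
  set ζ' := if n ≤ m then weightedHomogeneousComponent (varWt n) (m - n) ζ else 0 with hζ'
  have hζ'_mem : ζ' ∈ weightLT k (varWt n) m := by
    rw [hζ']
    split_ifs with hnm
    · exact weightedHomogeneousComponent_mem_weightLT _ (by omega) _
    · exact Submodule.zero_mem _
  refine ⟨ζ', ξ - weightedHomogeneousComponent (varWt n) m ξ - eulerDer ![0, 1, -1] ζ',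
    Submodule.sub_mem _ (sub_weightedHomogeneousComponent_mem_weightLT hξ)
      (eulerDer_mem_weightLT hζ'_mem _),
    η - weightedHomogeneousComponent (varWt n) m η + eulerDer ![1, 0, -1] ζ',
    Submodule.add_mem _ (sub_weightedHomogeneousComponent_mem_weightLT hη)
      (eulerDer_mem_weightLT hζ'_mem _), ?_, ?_⟩
  · convert hζξ' using 1
    rw [redDy, twistedDer_apply]; ring
  · convert hζη' using 1
    rw [redDx, twistedDer_apply]; ring

theorem eq_zero_of_xyz_dvd_totalMap [IsDomain k] {n : ℕ} (hn : 0 < n) {t : k}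
    (hnk : IsUnit (n : k)) (ht : IsUnit t) {v : Fin (2 * n + 1) → k}
    {ξ η : MvPolynomial (Fin 3) k}
    (h : xyz k ∣ totalMap (basisMonomial k n) (redDx n t) (redDy t) (v, ξ, η)) :
    v = 0 ∧ ∃ ζ, xyz k ∣ ξ - redDy t ζ ∧ xyz k ∣ η + redDx n t ζ := by
  obtain ⟨m₁, h₁⟩ := exists_mem_weightLT (varWt n) ξ
  obtain ⟨m₂, h₂⟩ := exists_mem_weightLT (varWt n) η
  obtain ⟨m, hξ, hη⟩ : ∃ m, ξ ∈ weightLT k (varWt n) m ∧ η ∈ weightLT k (varWt n) m :=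
    ⟨max m₁ m₂, weightLT_mono _ (le_max_left _ _) h₁, weightLT_mono _ (le_max_right _ _) h₂⟩
  clear h₁ h₂
  induction m generalizing ξ η with
  | zero =>
    rw [mem_weightLT_zero.1 hξ, mem_weightLT_zero.1 hη] at h ⊢
    refine ⟨eq_zero_of_xyz_dvd_symb (t := t) (ξ := 0) (η := 0) hnk ht ?_, 0, by simp, by simp⟩
    simpa [totalMap_apply] using h
  | succ m ih =>
    obtain ⟨ζ, ξ', hξ', η', hη', hdξ, hdη⟩ :=
      exists_weightLT_of_xyz_dvd_totalMap hn hnk ht hξ hη h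
    have h' : xyz k ∣ totalMap (basisMonomial k n) (redDx n t) (redDy t) (v, ξ', η') := by
      have hx : xyz k ∣ redDx n t _ := monomial_one_dvd_twistedDer hdξ _ _
      have hy : xyz k ∣ redDy t _ := monomial_one_dvd_twistedDer hdη _ _
      convert dvd_sub (dvd_sub h hx) hy using 1
      simp only [totalMap_apply, map_sub, map_add, redDx_comm_redDy]
      ring
    obtain ⟨hv, ζ', hξζ, hηζ⟩ := ih h' hξ' hη'
    refine ⟨hv, ζ + ζ', ?_, ?_⟩
    · convert dvd_add hdξ hξζ using 1
      rw [map_add]; ring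
    · convert dvd_add hdη hηζ using 1
      rw [map_add]; ring

end ThreeVariables

end Graded

/-! ### Uniformizers of compact rings -/

section Uniformizer

theorem mem_of_isFixedPt_of_dist_le {X : Type*} [MetricSpace X] {K : Set X} (hK : IsCompact K)
    (hne : K.Nonempty) {F : X → X} (hF : Set.MapsTo F K K) {y : X} (hy : F.IsFixedPt y) {c : ℝ}
    (hc : c < 1) (hdist : ∀ z ∈ K, dist (F y) (F z) ≤ c * dist y z) : y ∈ K := by
  obtain ⟨z, hz, hyz⟩ := hK.exists_infDist_eq_dist hne y
  have hle : dist y z ≤ c * dist y z :=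
    calc dist y z = Metric.infDist y K := hyz.symm
      _ ≤ dist y (F z) := Metric.infDist_le_dist_of_mem (hF hz)
      _ = dist (F y) (F z) := by rw [hy.eq]
      _ ≤ c * dist y z := hdist z hz
  have hzero : dist y z = 0 := by nlinarith [dist_nonneg (x := y) (y := z)]
  rwa [dist_eq_zero.1 hzero]

theorem exists_eq_algebraMap_add_mul_of_mem_adjoin {R S : Type*} [CommRing R] [CommRing S]
    [Algebra R S] {g x : S} (hx : x ∈ Algebra.adjoin R {g}) :
    ∃ r : R, ∃ y ∈ Algebra.adjoin R {g}, x = algebraMap R S r + g * y := by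
  rw [Algebra.adjoin_singleton_eq_range_aeval] at hx ⊢
  obtain ⟨P, rfl⟩ := hx
  refine ⟨P.coeff 0, _, ⟨P.divX, rfl⟩, ?_⟩
  have h := congrArg (Polynomial.aeval g) P.X_mul_divX_add
  rw [map_add, map_mul, Polynomial.aeval_X, Polynomial.aeval_C] at h
  exact h.symm.trans (add_comm _ _)

theorem toSubring_adjoin_range {R S : Type*} [CommRing R] [CommRing S] [Algebra R S] (s : Set S) :
    (Algebra.adjoin (algebraMap R S).range s).toSubring = (Algebra.adjoin R s).toSubring := by
  simp only [Algebra.adjoin_eq_ring_closure]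
  congr 2
  exact Subtype.range_coe

theorem tsum_mem_of_isClosed {R ι : Type*} [Ring R] [TopologicalSpace R] {A : Subring R}
    (hA : IsClosed (A : Set R)) {f : ι → R} (hf : ∀ i, f i ∈ A) : ∑' i, f i ∈ A := by
  by_cases h : Summable f
  · exact hA.mem_of_tendsto h.hasSum (Eventually.of_forall fun s => A.sum_mem fun i _ => hf i)
  · rw [tsum_eq_zero_of_not_summable h]
    exact A.zero_mem

variable {K : Type*} [NormedField K]

theorem norm_le_one_of_isCompact {A : Subring K} (hA : IsCompact (A : Set K)) {x : K}
    (hx : x ∈ A) : ‖x‖ ≤ 1 := by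
  obtain ⟨C, hC⟩ := hA.isBounded.exists_norm_le
  by_contra! h
  obtain ⟨k, hk⟩ := pow_unbounded_of_one_lt C h
  exact absurd (hC _ (pow_mem hx k)) (by rw [norm_pow]; exact hk.not_ge)

theorem norm_pow_sub_pow_le [IsUltrametricDist K] {y z : K} (hy : ‖y‖ ≤ 1) (hz : ‖z‖ ≤ 1)
    (m : ℕ) : ‖y ^ m - z ^ m‖ ≤ ‖y - z‖ := by
  rw [← (Commute.all y z).geom_sum₂_mul, norm_mul]
  refine mul_le_of_le_one_left (norm_nonneg _)
    (IsUltrametricDist.norm_sum_le_of_forall_le_of_nonneg zero_le_one fun i _ => ?_)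
  rw [norm_mul, norm_pow, norm_pow]
  exact mul_le_one₀ (pow_le_one₀ (norm_nonneg _) hy) (by positivity)
    (pow_le_one₀ (norm_nonneg _) hz)

/-- `y` is the fixed point of the contraction `z ↦ b - ∑ c k z ^ e k` of `A`. -/
theorem mem_of_hasSum_mul_pow [IsUltrametricDist K] [CompleteSpace K] {A : Subring K}
    (hA : IsCompact (A : Set K)) {b y : K} (hb : b ∈ A) (hy : ‖y‖ ≤ 1) {c : ℕ → K} {e : ℕ → ℕ}
    (hcA : ∀ k, c k ∈ A) {r : ℝ} (hr0 : 0 ≤ r) (hr : r < 1) (hc : ∀ k, ‖c k‖ ≤ r ^ (k + 1))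
    (hsum : HasSum (fun k => c k * y ^ e k) (b - y)) : y ∈ A := by
  have hsummable : ∀ z : K, ‖z‖ ≤ 1 → Summable fun k => c k * z ^ e k := fun z hz => by
    refine Summable.of_norm_bounded (g := fun k => r ^ (k + 1))
      ((summable_nat_add_iff 1).2 (summable_geometric_of_lt_one hr0 hr)) fun k => ?_
    rw [norm_mul, norm_pow z]
    exact (mul_le_of_le_one_right (norm_nonneg _) (pow_le_one₀ (norm_nonneg _) hz)).trans (hc k)
  refine mem_of_isFixedPt_of_dist_le hA ⟨0, A.zero_mem⟩ (F := fun z => b - ∑' k, c k * z ^ e k)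
    (fun z hz => A.sub_mem hb (tsum_mem_of_isClosed hA.isClosed fun k =>
      A.mul_mem (hcA k) (pow_mem hz _))) ?_ hr fun z hz => ?_
  · rw [Function.IsFixedPt, hsum.tsum_eq, sub_sub_cancel]
  · have hz1 := norm_le_one_of_isCompact hA hz
    rw [dist_sub_left, dist_comm, dist_eq_norm, dist_comm, dist_eq_norm,
      ← (hsummable z hz1).tsum_sub (hsummable y hy)]
    refine IsUltrametricDist.norm_tsum_le_of_forall_le_of_nonneg (by positivity) fun k => ?_
    rw [← mul_sub, norm_mul]
    exact mul_le_mul ((hc k).trans (pow_le_of_le_one hr0 hr.le (Nat.succ_ne_zero k)))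
      (norm_pow_sub_pow_le hz1 hy _) (norm_nonneg _) hr0

/-- `π` is a uniformizer of the compact subring `A` of the normed field `K`: it generates the ideal
of the elements of `A` of norm less than `1`. -/
structure IsUniformizer (A : Subring K) (π : K) : Prop where
  isCompact : IsCompact (A : Set K)
  mem : π ∈ A
  ne_zero : π ≠ 0
  norm_lt_one : ‖π‖ < 1
  exists_eq_mul : ∀ x ∈ A, ‖x‖ < 1 → ∃ y ∈ A, x = π * y

variable {A : Subring K} {π : K}

theorem IsUniformizer.norm_le_one (h : IsUniformizer A π) {x : K} (hx : x ∈ A) : ‖x‖ ≤ 1 :=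
  norm_le_one_of_isCompact h.isCompact hx

theorem IsUniformizer.exists_eq_pow_mul (h : IsUniformizer A π) (m : ℕ) {x : K} (hx : x ∈ A)
    (hm : ‖x‖ ≤ ‖π‖ ^ m) : ∃ y ∈ A, x = π ^ m * y := by
  induction m with
  | zero => exact ⟨x, hx, by simp⟩
  | succ m ih =>
    have hπ0 : 0 < ‖π‖ := norm_pos_iff.2 h.ne_zero
    obtain ⟨y, hy, rfl⟩ :=
      ih (hm.trans (pow_le_pow_of_le_one hπ0.le h.norm_lt_one.le (Nat.le_succ m)))
    rw [norm_mul, norm_pow, pow_succ] at hm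
    obtain ⟨z, hz, rfl⟩ := h.exists_eq_mul y hy
      ((le_of_mul_le_mul_left hm (pow_pos hπ0 m)).trans_lt h.norm_lt_one)
    exact ⟨z, hz, by ring⟩

/-- An element `x` of norm less than `1` is the limit of `x - x ^ q ^ k ∈ π A`. -/
theorem exists_eq_mul_of_forall_pow_eq (hA : IsCompact (A : Set K)) {q : ℕ} (hq : 1 < q)
    (hpow : ∀ x ∈ A, ∃ y ∈ A, x ^ q = x + π * y) {x : K} (hx : x ∈ A) (hx1 : ‖x‖ < 1) :
    ∃ y ∈ A, x = π * y := by
  have hclosed : IsClosed ((fun y => π * y) '' (A : Set K)) :=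
    (hA.image (by fun_prop)).isClosed
  have hmem : ∀ k, x - x ^ q ^ k ∈ (fun y => π * y) '' (A : Set K) := fun k => by
    induction k with
    | zero => exact ⟨0, A.zero_mem, by simp⟩
    | succ k ih =>
      obtain ⟨y, hy, hxy⟩ := ih
      obtain ⟨z, hz, hxz⟩ := hpow _ (pow_mem hx (q ^ k))
      exact ⟨y - z, A.sub_mem hy hz, by simp only [pow_succ, pow_mul, hxz] at hxy ⊢; grind⟩
  have hlim : Tendsto (fun k => x - x ^ q ^ k) atTop (𝓝 x) := by
    simpa using tendsto_const_nhds.sub ((tendsto_pow_atTop_nhds_zero_of_norm_lt_one hx1).comp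
      (tendsto_pow_atTop_atTop_of_one_lt hq))
  obtain ⟨y, hy, hxy⟩ := hclosed.mem_of_tendsto hlim (Eventually.of_forall hmem)
  exact ⟨y, hy, hxy.symm⟩

theorem isCompact_adjoin (hA : IsCompact (A : Set K)) {s : Set K} (hs : s.Finite)
    (hint : ∀ x ∈ s, IsIntegral A x) : IsCompact (Algebra.adjoin A s : Set K) :=
  have : CompactSpace A := isCompact_iff_compactSpace.1 hA
  Submodule.isCompact_of_fg (fg_adjoin_of_finite hs hint)

theorem IsUniformizer.adjoin [IsUltrametricDist K] (h : IsUniformizer A π) {g y : K} {N : ℕ}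
    (hN : N ≠ 0) (hy : y ∈ A) (hy' : y⁻¹ ∈ A) (hy0 : y ≠ 0) (hg : g ^ N = π * y) :
    IsUniformizer (Algebra.adjoin A {g}).toSubring g := by
  have hA : ∀ x ∈ A, x ∈ Algebra.adjoin A {g} := fun x hx =>
    (Algebra.adjoin A {g}).algebraMap_mem ⟨x, hx⟩
  have hgmem : g ∈ Algebra.adjoin A {g} := Algebra.self_mem_adjoin_singleton A g
  have hcompact : IsCompact (Algebra.adjoin A {g} : Set K) := by
    refine isCompact_adjoin h.isCompact (Set.finite_singleton g) ?_
    rintro _ rfl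
    refine IsIntegral.of_pow (Nat.pos_of_ne_zero hN) ?_
    exact hg ▸ isIntegral_algebraMap (x := (⟨π * y, A.mul_mem h.mem hy⟩ : A))
  have hg1 : ‖g‖ < 1 := by
    rw [← pow_lt_one_iff_of_nonneg (norm_nonneg g) hN, ← norm_pow, hg, norm_mul]
    exact mul_lt_one_of_nonneg_of_lt_one_left (norm_nonneg π) h.norm_lt_one (h.norm_le_one hy)
  have hπ : π = g * (g ^ (N - 1) * y⁻¹) := by
    rw [← mul_assoc, mul_pow_sub_one hN, hg, mul_inv_cancel_right₀ hy0]
  refine ⟨hcompact, hgmem, ?_, hg1, fun x hx hx1 => ?_⟩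
  · rintro rfl
    exact h.ne_zero (by rw [hπ, zero_mul])
  · obtain ⟨⟨w, hw⟩, z, hz, rfl⟩ := exists_eq_algebraMap_add_mul_of_mem_adjoin hx
    have hz1 : ‖z‖ ≤ 1 :=
      norm_le_one_of_isCompact (A := (Algebra.adjoin A {g}).toSubring) hcompact hz
    change ‖w + g * z‖ < 1 at hx1
    have hw1 : ‖w‖ < 1 := by
      rw [← add_neg_cancel_right w (g * z)]
      refine (IsUltrametricDist.norm_add_le_max _ _).trans_lt (max_lt hx1 ?_)
      rw [norm_neg, norm_mul]
      exact mul_lt_one_of_nonneg_of_lt_one_left (norm_nonneg g) hg1 hz1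
    obtain ⟨w', hw', rfl⟩ := h.exists_eq_mul w hw hw1
    refine ⟨g ^ (N - 1) * y⁻¹ * w' + z, add_mem (mul_mem (mul_mem (pow_mem hgmem _)
      (hA _ hy')) (hA _ hw')) hz, ?_⟩
    change π * w' + g * z = g * (g ^ (N - 1) * y⁻¹ * w' + z)
    rw [mul_add, ← mul_assoc, ← hπ]

end Uniformizer

/-! ### The number `γ` -/

section Gamma

variable (p : ℕ) [Fact p.Prime]

/-- The inclusion of `ℤ_p` into `ℂ_p`. -/
def zpHom : ℤ_[p] →+* ℂ_[p] := (algebraMap ℚ_[p] ℂ_[p]).comp PadicInt.Coe.ringHom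

/-- `ℤ_p` as a subring of `ℂ_p`. -/
def ZpC : Subring ℂ_[p] := (zpHom p).range

variable {p}

theorem norm_zpHom (z : ℤ_[p]) : ‖zpHom p z‖ = ‖z‖ := by
  rw [PadicInt.norm_def]
  exact norm_algebraMap' ℂ_[p] (z : ℚ_[p])

theorem norm_p : ‖(p : ℂ_[p])‖ = (p : ℝ)⁻¹ := by
  rw [← map_natCast (zpHom p), norm_zpHom, PadicInt.norm_p]

theorem p_ne_zero : (p : ℂ_[p]) ≠ 0 := Nat.cast_ne_zero.2 (Fact.out : p.Prime).ne_zero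

theorem inv_p_lt_one : (p : ℝ)⁻¹ < 1 :=
  inv_lt_one_of_one_lt₀ (mod_cast (Fact.out : p.Prime).one_lt)

theorem isCompact_ZpC : IsCompact (ZpC p : Set ℂ_[p]) := by
  rw [ZpC, RingHom.coe_range]
  exact isCompact_range (f := zpHom p)
    ((continuous_algebraMap ℚ_[p] ℂ_[p]).comp continuous_subtype_val)

theorem inv_mem_ZpC {z : ℂ_[p]} (hz : z ∈ ZpC p) (h : ‖z‖ = 1) : z⁻¹ ∈ ZpC p := by
  obtain ⟨z, rfl⟩ := hz
  rw [norm_zpHom] at h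
  obtain ⟨w, hw⟩ := (PadicInt.isUnit_iff.2 h).exists_right_inv
  refine ⟨w, eq_inv_of_mul_eq_one_right ?_⟩
  rw [← map_mul, hw, map_one]

theorem norm_pow_sub_one_of_norm_eq {γ : ℂ_[p]}
    (hγ : ‖γ‖ = (p : ℝ) ^ (-(1 / ((p : ℝ) - 1)))) : ‖γ‖ ^ (p - 1) = (p : ℝ)⁻¹ := by
  have hp : 1 < p := (Fact.out : p.Prime).one_lt
  have hp' : (p : ℝ) - 1 ≠ 0 := sub_ne_zero.2 (mod_cast hp.ne')
  rw [hγ, ← Real.rpow_natCast, ← Real.rpow_mul (by positivity), Nat.cast_sub hp.le, Nat.cast_one,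
    neg_mul, one_div_mul_cancel hp', Real.rpow_neg_one]

theorem two_mul_le_geom_sum_add_one {m : ℕ} (hm : 2 ≤ m) (k : ℕ) :
    2 * k ≤ ∑ i ∈ Finset.range k, m ^ i + 1 := by
  induction k with
  | zero => simp
  | succ k ih =>
    rw [Finset.sum_range_succ]
    rcases Nat.eq_zero_or_pos k with rfl | hk
    · simp
    · have : 2 ≤ m ^ k := hm.trans (Nat.le_self_pow hk.ne' m)
      omega

theorem pow_p_pow_div_eq (γ : ℂ_[p]) (k : ℕ) :
    γ ^ p ^ k / (p : ℂ_[p]) ^ k = γ * ((p : ℂ_[p]) ^ (∑ i ∈ Finset.range k, p ^ i - k) *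
      (γ ^ (p - 1) / p) ^ ∑ i ∈ Finset.range k, p ^ i) := by
  have hp := (Fact.out : p.Prime).two_le
  set M := ∑ i ∈ Finset.range k, p ^ i with hM
  have hpk : p ^ k = (p - 1) * M + 1 := by
    rw [mul_comm, ← Nat.sub_add_cancel (by omega : 1 ≤ p), hM]
    simpa only [Nat.sub_add_cancel (by omega : 1 ≤ p)] using (geom_sum_mul_add (p - 1) k).symm
  have hkM : k ≤ M := by
    have := two_mul_le_geom_sum_add_one hp k
    omega
  have hsplit : (p : ℂ_[p]) ^ M = (p : ℂ_[p]) ^ (M - k) * (p : ℂ_[p]) ^ k := by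
    rw [← pow_add, Nat.sub_add_cancel hkM]
  rw [hpk, pow_succ, pow_mul, div_pow, hsplit]
  have := p_ne_zero (p := p)
  field_simp

/-- Divided by `γ`, the equation `∑ γ ^ p ^ k / p ^ k = 0` becomes an equation for
`γ ^ (p - 1) / p` alone, to which the contraction principle applies. -/
theorem gamma_pow_div_mem_ZpC {γ : ℂ_[p]} (hγ : ‖γ‖ ^ (p - 1) = (p : ℝ)⁻¹)
    (hsum : HasSum (fun k : ℕ => γ ^ p ^ k / (p : ℂ_[p]) ^ k) 0) :
    γ ^ (p - 1) / p ∈ ZpC p := by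
  have hp := (Fact.out : p.Prime).two_le
  have hinv : (p : ℝ)⁻¹ ≠ 0 := inv_ne_zero (by positivity)
  have hγ0 : γ ≠ 0 := by
    rintro rfl
    exact hinv (by rw [← hγ, norm_zero, zero_pow (by omega)])
  have hnorm : ‖γ ^ (p - 1) / (p : ℂ_[p])‖ = 1 := by
    rw [norm_div, norm_pow, hγ, norm_p, div_self hinv]
  simp only [pow_p_pow_div_eq] at hsum
  have hdiv := (hasSum_mul_left_iff hγ0 (a₁ := 0)).1 (by rwa [mul_zero])
  have htail := (hasSum_nat_add_iff' 2).2 hdiv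
  have hhead : 0 - ∑ k ∈ Finset.range 2, (p : ℂ_[p]) ^ (∑ i ∈ Finset.range k, p ^ i - k) *
      (γ ^ (p - 1) / p) ^ ∑ i ∈ Finset.range k, p ^ i = -1 - γ ^ (p - 1) / p := by
    simp [Finset.sum_range_succ, sub_eq_add_neg, add_comm]
  rw [hhead] at htail
  refine mem_of_hasSum_mul_pow isCompact_ZpC (neg_mem (one_mem (ZpC p))) hnorm.le
    (fun k => pow_mem (natCast_mem (ZpC p) p) _) (by positivity) inv_p_lt_one (fun k => ?_) htail
  rw [norm_pow, norm_p]
  refine pow_le_pow_of_le_one (by positivity) inv_p_lt_one.le ?_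
  have := two_mul_le_geom_sum_add_one hp (k + 2)
  omega

theorem pow_add_sub_one_mul_le_pow {m : ℕ} (hm : 2 ≤ m) (i j : ℕ) :
    m ^ i + i + (m - 1) * (j + 1) ≤ m ^ (i + (j + 1)) := by
  obtain ⟨l, rfl⟩ := Nat.exists_eq_add_of_le' (show 1 ≤ m by omega)
  rw [Nat.add_sub_cancel]
  induction j with
  | zero =>
    have h1 : i + 1 ≤ (l + 1) ^ i := Nat.lt_pow_self (by omega)
    have h2 : i ≤ l * i := Nat.le_mul_of_pos_left _ (by omega)
    calc _ ≤ (l + 1) ^ i + l * (i + 1) := by nlinarith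
      _ ≤ (l + 1) ^ i + l * (l + 1) ^ i := by gcongr
      _ = (l + 1) ^ (i + (0 + 1)) := by ring
  | succ j ih =>
    have h1 : 1 ≤ (l + 1) ^ (i + (j + 1)) := Nat.one_le_pow _ _ (by omega)
    calc _ = (l + 1) ^ i + i + l * (j + 1) + l * 1 := by ring
      _ ≤ (l + 1) ^ (i + (j + 1)) + l * (l + 1) ^ (i + (j + 1)) := by gcongr
      _ = (l + 1) ^ (i + (j + 1 + 1)) := by ring

/-- As `∑ γ ^ p ^ k / p ^ k = 0`, the partial sum `γ_i` is the opposite of a tail. -/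
theorem norm_gammaSeq_mul_le {γ : ℂ_[p]} (hγ : ‖γ‖ ^ (p - 1) = (p : ℝ)⁻¹)
    (hsum : HasSum (fun k : ℕ => γ ^ p ^ k / (p : ℂ_[p]) ^ k) 0) (i : ℕ) :
    ‖gammaSeq p γ i * (p : ℂ_[p]) ^ i‖ ≤ ‖γ‖ ^ (p ^ i + i) := by
  have hp := (Fact.out : p.Prime).two_le
  have hp0 : (0 : ℝ) < (p : ℝ)⁻¹ := by positivity
  have hγ1 : ‖γ‖ ≤ 1 := by
    rw [← pow_le_one_iff_of_nonneg (norm_nonneg γ) (show p - 1 ≠ 0 by omega), hγ]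
    exact inv_p_lt_one.le
  have htail := ((hasSum_nat_add_iff' (i + 1)).2 hsum).tsum_eq
  rw [zero_sub] at htail
  rw [gammaSeq, ← norm_neg, ← neg_mul, ← htail, ← tsum_mul_right]
  refine IsUltrametricDist.norm_tsum_le_of_forall_le_of_nonneg (by positivity) fun k => ?_
  rw [norm_mul, norm_div, norm_pow, norm_pow, norm_pow, norm_p, ← add_assoc, add_right_comm,
    pow_add (p : ℝ)⁻¹ (k + 1), div_mul_eq_mul_div, mul_div_mul_right _ _ (pow_pos hp0 i).ne',
    div_le_iff₀ (pow_pos hp0 _), ← hγ, ← pow_mul, ← pow_add, add_comm (k + 1)]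
  exact pow_le_pow_of_le_one (norm_nonneg _) hγ1 (pow_add_sub_one_mul_le_pow hp i k)

end Gamma

/-! ### The rings `ℤ_q` and `ℤ_q[g]` -/

section UnramifiedRing

variable {p : ℕ} [Fact p.Prime] {a : ℕ}

variable (p a) in
/-- The set `μ_{q-1}` of the `(q-1)`-st roots of unity in `ℂ_p`, `q = p ^ a`. -/
def unityRoots : Set ℂ_[p] := {z : ℂ_[p] | z ^ (p ^ a - 1) = 1}

variable (p a) in
/-- The ring `ℤ_p[μ_{q-1}]`, which turns out to be `ℤ_q`. -/
def unramInt : Subalgebra (ZpC p) ℂ_[p] := Algebra.adjoin (ZpC p) (unityRoots p a)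

theorem p_pow_sub_one_pos (ha : 0 < a) : 0 < p ^ a - 1 :=
  Nat.sub_pos_of_lt (Nat.one_lt_pow ha.ne' (Fact.out : p.Prime).one_lt)

theorem isIntegral_of_mem_unityRoots {A : Type*} [CommRing A] [Algebra A ℂ_[p]] (ha : 0 < a)
    {z : ℂ_[p]} (hz : z ∈ unityRoots p a) : IsIntegral A z :=
  IsIntegral.of_pow (p_pow_sub_one_pos ha) (by rw [show z ^ _ = 1 from hz]; exact isIntegral_one)

theorem isCompact_unramInt (ha : 0 < a) : IsCompact (unramInt p a : Set ℂ_[p]) := by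
  refine isCompact_adjoin isCompact_ZpC ?_ fun _ => isIntegral_of_mem_unityRoots ha
  refine (Polynomial.finite_setOfPred_isRoot (Polynomial.X_pow_sub_C_ne_zero
    (p_pow_sub_one_pos (p := p) ha) (1 : ℂ_[p]))).subset fun z hz => ?_
  simpa [unityRoots, sub_eq_zero] using hz

theorem zpHom_mem_unramInt (z : ℤ_[p]) : zpHom p z ∈ unramInt p a :=
  (unramInt p a).algebraMap_mem ⟨_, z, rfl⟩

theorem exists_pow_eq_add_p_mul {w : ℂ_[p]} (hw : w ∈ unramInt p a) :
    ∃ w' ∈ unramInt p a, w ^ p ^ a = w + p * w' := by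
  have hp := (Fact.out : p.Prime)
  induction hw using Algebra.adjoin_induction with
  | mem x hx =>
    refine ⟨0, zero_mem _, ?_⟩
    rw [mul_zero, add_zero, ← Nat.sub_add_cancel (Nat.one_le_pow a p hp.pos), pow_succ,
      show x ^ (p ^ a - 1) = 1 from hx, one_mul]
  | algebraMap r =>
    obtain ⟨_, z, rfl⟩ := r
    have hker : z ^ p ^ a - z ∈ RingHom.ker (PadicInt.toZMod (p := p)) := by
      rw [RingHom.mem_ker, map_sub, map_pow, ZMod.pow_card_pow, sub_self]
    rw [PadicInt.ker_toZMod, PadicInt.maximalIdeal_eq_span_p, Ideal.mem_span_singleton] at hker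
    obtain ⟨z', hz'⟩ := hker
    refine ⟨zpHom p z', zpHom_mem_unramInt z', ?_⟩
    change zpHom p z ^ p ^ a = zpHom p z + p * zpHom p z'
    rw [← map_natCast (zpHom p), ← map_mul, ← hz', ← map_add, ← map_pow, add_sub_cancel]
  | add x y hx hy ihx ihy =>
    obtain ⟨x', hx', ex⟩ := ihx
    obtain ⟨y', hy', ey⟩ := ihy
    obtain ⟨⟨r, hr⟩, hxy⟩ := exists_add_pow_prime_pow_eq hp (⟨x, hx⟩ : unramInt p a) ⟨y, hy⟩ a
    refine ⟨x' + y' + x * y * r, add_mem (add_mem hx' hy') (mul_mem (mul_mem hx hy) hr), ?_⟩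
    have hxy' : (x + y) ^ p ^ a = x ^ p ^ a + y ^ p ^ a + p * x * y * r := congrArg Subtype.val hxy
    rw [hxy', ex, ey]
    ring
  | mul x y hx hy ihx ihy =>
    obtain ⟨x', hx', ex⟩ := ihx
    obtain ⟨y', hy', ey⟩ := ihy
    refine ⟨x * y' + x' * y + p * x' * y', add_mem (add_mem (mul_mem hx hy') (mul_mem hx' hy))
      (mul_mem (mul_mem (natCast_mem _ p) hx') hy'), ?_⟩
    rw [mul_pow, ex, ey]
    ring

theorem isUniformizer_unramInt (ha : 0 < a) :
    IsUniformizer (unramInt p a).toSubring (p : ℂ_[p]) := by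
  have hcompact : IsCompact ((unramInt p a).toSubring : Set ℂ_[p]) := isCompact_unramInt ha
  refine ⟨hcompact, natCast_mem _ p, p_ne_zero, norm_p.trans_lt inv_p_lt_one, fun x hx hx1 => ?_⟩
  exact exists_eq_mul_of_forall_pow_eq hcompact
    (Nat.one_lt_pow ha.ne' (Fact.out : p.Prime).one_lt)
    (fun w hw => exists_pow_eq_add_p_mul (w := w) hw) hx hx1

theorem exists_p_pow_mul_mem_unramInt (ha : 0 < a) {z : ℂ_[p]} (hz : z ∈ Qq p a) :
    ∃ m : ℕ, (p : ℂ_[p]) ^ m * z ∈ unramInt p a := by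
  have hadjoin : z ∈ Algebra.adjoin ℚ_[p] (unityRoots p a) := by
    rw [← IntermediateField.adjoin_toSubalgebra_of_isAlgebraic]
    · exact hz
    · exact fun x hx => (isIntegral_of_mem_unityRoots ha hx).isAlgebraic
  have hp (m : ℕ) : (p : ℂ_[p]) ^ m ∈ unramInt p a := pow_mem (natCast_mem _ p) m
  clear hz
  induction hadjoin using Algebra.adjoin_induction with
  | mem x hx => exact ⟨0, by rw [pow_zero, one_mul]; exact Algebra.subset_adjoin hx⟩
  | algebraMap r =>
    obtain ⟨m, hm⟩ := exists_pow_lt_of_lt_one (show 0 < (‖r‖ + 1)⁻¹ by positivity)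
      (Padic.norm_p_lt_one (p := p))
    have hle : ‖(p : ℚ_[p]) ^ m * r‖ ≤ 1 := by
      rw [norm_mul, norm_pow]
      calc _ ≤ (‖r‖ + 1)⁻¹ * (‖r‖ + 1) := by gcongr; linarith
        _ = 1 := inv_mul_cancel₀ (by positivity)
    have hmem : algebraMap ℚ_[p] ℂ_[p] ((p : ℚ_[p]) ^ m * r) ∈ unramInt p a :=
      zpHom_mem_unramInt ⟨_, hle⟩
    exact ⟨m, by rwa [map_mul, map_pow, map_natCast] at hmem⟩
  | add x y _ _ ihx ihy =>
    obtain ⟨m, hm⟩ := ihx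
    obtain ⟨l, hl⟩ := ihy
    refine ⟨m + l, ?_⟩
    convert add_mem (mul_mem (hp l) hm) (mul_mem (hp m) hl) using 1
    ring
  | mul x y _ _ ihx ihy =>
    obtain ⟨m, hm⟩ := ihx
    obtain ⟨l, hl⟩ := ihy
    refine ⟨m + l, ?_⟩
    convert mul_mem hm hl using 1
    ring

theorem norm_coe_Zq_le_one (z : Zq p a) : ‖((z : Qq p a) : ℂ_[p])‖ ≤ 1 := z.2

theorem mem_range_algebraMap_Zq {z : ℂ_[p]} :
    z ∈ (algebraMap (Zq p a) ℂ_[p]).range ↔ z ∈ Qq p a ∧ ‖z‖ ≤ 1 :=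
  ⟨by rintro ⟨w, rfl⟩; exact ⟨(w : Qq p a).2, norm_coe_Zq_le_one w⟩,
    fun h => ⟨⟨⟨z, h.1⟩, h.2⟩, rfl⟩⟩

theorem range_algebraMap_Zq (ha : 0 < a) :
    (algebraMap (Zq p a) ℂ_[p]).range = (unramInt p a).toSubring := by
  have hu := isUniformizer_unramInt (p := p) ha
  ext z
  rw [mem_range_algebraMap_Zq]
  refine ⟨fun ⟨hz, hz1⟩ => ?_, fun hz => ⟨?_, hu.norm_le_one hz⟩⟩
  · obtain ⟨m, hm⟩ := exists_p_pow_mul_mem_unramInt ha hz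
    obtain ⟨w, hw, e⟩ := hu.exists_eq_pow_mul m hm (by
      rw [norm_mul, norm_pow]
      exact mul_le_of_le_one_right (by positivity) hz1)
    rwa [mul_left_cancel₀ (pow_ne_zero m p_ne_zero) e]
  · induction hz using Algebra.adjoin_induction with
    | mem x hx => exact IntermediateField.subset_adjoin _ _ hx
    | algebraMap r =>
      obtain ⟨_, z, rfl⟩ := r
      exact (Qq p a).algebraMap_mem (z : ℚ_[p])
    | add x y _ _ hx hy => exact add_mem hx hy
    | mul x y _ _ hx hy => exact mul_mem hx hy

theorem coe_Zq_mem_ZqAdjoin (g : ℂ_[p]) (z : Zq p a) : ((z : Qq p a) : ℂ_[p]) ∈ ZqAdjoin p a g :=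
  (Algebra.adjoin (Zq p a) {g}).algebraMap_mem z

variable {n : ℕ} {g γ : ℂ_[p]}

theorem isUniformizer_ZqAdjoin (ha : 0 < a) (hn : 0 < n) (hg : g ^ n = γ)
    (hγ : ‖γ‖ ^ (p - 1) = (p : ℝ)⁻¹)
    (hsum : HasSum (fun k : ℕ => γ ^ p ^ k / (p : ℂ_[p]) ^ k) 0) :
    IsUniformizer (ZqAdjoin p a g) g := by
  have hp := (Fact.out : p.Prime).two_le
  have hnorm : ‖γ ^ (p - 1) / (p : ℂ_[p])‖ = 1 := by
    rw [norm_div, norm_pow, hγ, norm_p, div_self (by positivity)]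
  have hmem : ∀ x ∈ ZpC p, x ∈ (unramInt p a).toSubring := by
    rintro _ ⟨z, rfl⟩
    exact zpHom_mem_unramInt z
  have hy := gamma_pow_div_mem_ZpC hγ hsum
  rw [ZqAdjoin, ← toSubring_adjoin_range, range_algebraMap_Zq ha]
  refine (isUniformizer_unramInt ha).adjoin (N := n * (p - 1))
    (Nat.mul_pos hn (by omega)).ne' (hmem _ hy) (hmem _ (inv_mem_ZpC hy hnorm))
    (norm_ne_zero_iff.1 (hnorm ▸ one_ne_zero)) ?_
  rw [pow_mul, hg, mul_div_cancel₀ _ p_ne_zero]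

theorem exists_gammaSeq_mul_eq (hu : IsUniformizer (ZqAdjoin p a g) g) (hn : 0 < n)
    (hg : g ^ n = γ) (hγ : ‖γ‖ ^ (p - 1) = (p : ℝ)⁻¹)
    (hsum : HasSum (fun k : ℕ => γ ^ p ^ k / (p : ℂ_[p]) ^ k) 0) :
    ∃ ρ : ℕ → ZqAdjoin p a g, ρ 0 = 1 ∧
      ∀ i, gammaSeq p γ i * (p : ℂ_[p]) ^ i = ρ i * g ^ i * g ^ (n * p ^ i) := by
  have hmem : ∀ i, gammaSeq p γ i * (p : ℂ_[p]) ^ i ∈ ZqAdjoin p a g := fun i => by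
    rw [gammaSeq, Finset.sum_mul]
    refine sum_mem fun k hk => ?_
    obtain ⟨j, rfl⟩ := Nat.exists_eq_add_of_le (Nat.lt_succ_iff.1 (Finset.mem_range.1 hk))
    rw [pow_add, ← mul_assoc, div_mul_cancel₀ _ (pow_ne_zero _ p_ne_zero), ← hg]
    exact mul_mem (pow_mem (pow_mem hu.mem _) _) (pow_mem (natCast_mem _ p) _)
  have hle : ∀ i, ‖gammaSeq p γ i * (p : ℂ_[p]) ^ i‖ ≤ ‖g‖ ^ (i + n * p ^ i) := fun i => by
    have hexp : i + n * p ^ i ≤ n * (p ^ i + i) := by nlinarith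
    refine (norm_gammaSeq_mul_le hγ hsum i).trans ?_
    rw [← hg, norm_pow, ← pow_mul]
    exact pow_le_pow_of_le_one (norm_nonneg g) hu.norm_lt_one.le hexp
  choose ρ hρ using fun i => hu.exists_eq_pow_mul _ (hmem i) (hle i)
  refine ⟨fun i => ⟨ρ i, (hρ i).1⟩, Subtype.ext ?_, fun i => by rw [(hρ i).2]; ring⟩
  refine mul_left_cancel₀ (pow_ne_zero n hu.ne_zero) ?_
  simpa [gammaSeq, hg, eq_comm] using (hρ 0).2

end UnramifiedRing

/-! ### Weights and exponents -/

section Weight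

theorem mMax_nonneg (u : ℤ × ℤ) : 0 ≤ mMax u := le_max_left _ _

theorem neg_fst_le_mMax (u : ℤ × ℤ) : -u.1 ≤ mMax u :=
  (le_max_left _ _).trans (le_max_right _ _)

theorem neg_snd_le_mMax (u : ℤ × ℤ) : -u.2 ≤ mMax u :=
  (le_max_right _ _).trans (le_max_right _ _)

theorem intCast_wt (n : ℕ) (u : ℤ × ℤ) :
    (wt n u : ℤ) = (u.1 + mMax u) + n * ((u.2 + mMax u) + mMax u) := by
  have hm := mMax_nonneg u
  have hfst := neg_fst_le_mMax u
  have hsnd := neg_snd_le_mMax u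
  have hmul : 0 ≤ (n : ℤ) * ((u.2 + mMax u) + mMax u) :=
    mul_nonneg (by positivity) (by linarith)
  have hsplit : u.1 + n * u.2 + (2 * n + 1) * mMax u
      = (u.1 + mMax u) + n * ((u.2 + mMax u) + mMax u) := by ring
  rw [wt, hsplit, Int.toNat_of_nonneg (by linarith)]

/-- The exponent of the monomial in `x`, `y`, `z = 1 / (xy)`, not divisible by `xyz`, which is equal
to the monomial with exponent `u`. -/
def expOf (u : ℤ × ℤ) : Fin 3 →₀ ℕ :=
  expo (u.1 + mMax u).toNat (u.2 + mMax u).toNat (mMax u).toNat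

theorem natCast_expOf_zero (u : ℤ × ℤ) : (expOf u 0 : ℤ) = u.1 + mMax u := by
  rw [expOf, expo_zero, Int.toNat_of_nonneg]
  linarith [neg_fst_le_mMax u]

theorem natCast_expOf_one (u : ℤ × ℤ) : (expOf u 1 : ℤ) = u.2 + mMax u := by
  rw [expOf, expo_one, Int.toNat_of_nonneg]
  linarith [neg_snd_le_mMax u]

theorem natCast_expOf_two (u : ℤ × ℤ) : (expOf u 2 : ℤ) = mMax u := by
  rw [expOf, expo_two, Int.toNat_of_nonneg (mMax_nonneg u)]

theorem expOf_eq_iff {u : ℤ × ℤ} {d : Fin 3 →₀ ℕ} : expOf u = d ↔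
    (u.1 = d 0 - d 2 ∧ u.2 = d 1 - d 2) ∧ (d 0 = 0 ∨ d 1 = 0 ∨ d 2 = 0) := by
  have hzero := natCast_expOf_zero u
  have hone := natCast_expOf_one u
  have htwo := natCast_expOf_two u
  have hm : mMax u = max 0 (max (-u.1) (-u.2)) := rfl
  constructor
  · rintro rfl
    omega
  · rintro ⟨⟨hfst, hsnd⟩, hd⟩
    refine finsupp_fin_three_ext ?_ ?_ ?_ <;> omega

theorem fst_eq_expOf (u : ℤ × ℤ) : u.1 = expOf u 0 - expOf u 2 := (expOf_eq_iff.1 rfl).1.1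

theorem snd_eq_expOf (u : ℤ × ℤ) : u.2 = expOf u 1 - expOf u 2 := (expOf_eq_iff.1 rfl).1.2

theorem expOf_eq_zero (u : ℤ × ℤ) : expOf u 0 = 0 ∨ expOf u 1 = 0 ∨ expOf u 2 = 0 :=
  (expOf_eq_iff.1 rfl).2

theorem expOf_injective : Function.Injective expOf := fun u v h =>
  Prod.ext (by rw [fst_eq_expOf u, h, ← fst_eq_expOf]) (by rw [snd_eq_expOf u, h, ← snd_eq_expOf])

theorem not_le_expOf (u : ℤ × ℤ) : ¬ expo 1 1 1 ≤ expOf u := by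
  intro h
  have hzero := h 0
  have hone := h 1
  have htwo := h 2
  have := expOf_eq_zero u
  simp only [expo_zero, expo_one, expo_two] at hzero hone htwo
  omega

theorem exists_expOf_eq {d : Fin 3 →₀ ℕ} (hd : ¬ expo 1 1 1 ≤ d) : ∃ u, expOf u = d := by
  refine ⟨(d 0 - d 2, d 1 - d 2), expOf_eq_iff.2 ⟨⟨rfl, rfl⟩, ?_⟩⟩
  by_contra! h
  refine hd fun i => ?_
  fin_cases i <;> simp <;> omega

theorem map_eq_expOf (f : ℤ × ℤ →+ ℤ) (u : ℤ × ℤ) :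
    f u = expOf u 0 * f (1, 0) + expOf u 1 * f (0, 1) + expOf u 2 * f (-1, -1) := by
  have hu : u = (expOf u 0 : ℤ) • ((1, 0) : ℤ × ℤ) + (expOf u 1 : ℤ) • ((0, 1) : ℤ × ℤ)
      + (expOf u 2 : ℤ) • ((-1, -1) : ℤ × ℤ) := by
    ext <;> simp [fst_eq_expOf u, snd_eq_expOf u, sub_eq_add_neg]
  conv_lhs => rw [hu]
  simp only [map_add, map_zsmul, smul_eq_mul]

theorem wt_eq_weight_expOf (n : ℕ) (u : ℤ × ℤ) : wt n u = Finsupp.weight (varWt n) (expOf u) := by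
  rw [eq_expo (expOf u), weight_varWt_expo]
  zify
  rw [intCast_wt, natCast_expOf_zero, natCast_expOf_one, natCast_expOf_two]

theorem expOf_sub_add_expOf {u v : ℤ × ℤ} (h : expOf v ≤ expOf u) :
    expOf (u - v) + expOf v = expOf u := by
  rw [← eq_tsub_iff_add_eq_of_le h, expOf_eq_iff]
  have hu := expOf_eq_zero u
  have hzero := h 0
  have hone := h 1
  have htwo := h 2
  simp only [Finsupp.tsub_apply, Prod.fst_sub, Prod.snd_sub, fst_eq_expOf u, fst_eq_expOf v,
    snd_eq_expOf u, snd_eq_expOf v]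
  omega

theorem wt_sub_add_wt {n : ℕ} {u v : ℤ × ℤ} (h : expOf v ≤ expOf u) :
    wt n (u - v) + wt n v = wt n u := by
  simp only [wt_eq_weight_expOf, ← map_add, expOf_sub_add_expOf h]

theorem wt_lt_wt_sub_add_wt {n : ℕ} {u v : ℤ × ℤ} (h : ¬ expOf v ≤ expOf u) :
    wt n u < wt n (u - v) + wt n v := by
  by_contra! hle
  zify at hle
  simp only [intCast_wt, Prod.fst_sub, Prod.snd_sub] at hle
  have hm : mMax (u - v) + mMax v ≤ mMax u := by nlinarith
  have hfst := neg_fst_le_mMax (u - v)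
  have hsnd := neg_snd_le_mMax (u - v)
  have hnonneg := mMax_nonneg (u - v)
  simp only [Prod.fst_sub, Prod.snd_sub] at hfst hsnd
  refine h fun i => ?_
  zify
  fin_cases i <;>
    simp only [Fin.zero_eta, Fin.mk_one, Fin.reduceFinMk, natCast_expOf_zero, natCast_expOf_one,
      natCast_expOf_two] <;>
    linarith

theorem wt_le_wt_sub_add_wt (n : ℕ) (u v : ℤ × ℤ) : wt n u ≤ wt n (u - v) + wt n v := by
  by_cases h : expOf v ≤ expOf u
  · exact (wt_sub_add_wt h).ge
  · exact (wt_lt_wt_sub_add_wt h).le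

theorem expOf_nsmul (m : ℕ) (u : ℤ × ℤ) : expOf (m • u) = m • expOf u := by
  rw [expOf_eq_iff]
  refine ⟨⟨?_, ?_⟩, (expOf_eq_zero u).imp (by simp [·]) (Or.imp (by simp [·]) (by simp [·]))⟩
  · simp [fst_eq_expOf u, mul_sub]
  · simp [snd_eq_expOf u, mul_sub]

theorem wt_nsmul (n m : ℕ) (u : ℤ × ℤ) : wt n (m • u) = m * wt n u := by
  simp only [wt_eq_weight_expOf, expOf_nsmul, map_nsmul, smul_eq_mul]

/-- The vertices of the triangle on which the weight is `1`. -/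
def vertex (n : ℕ) : Fin 3 → ℤ × ℤ := ![((n : ℤ), 0), (0, 1), (-1, -1)]

theorem expOf_vertex (n : ℕ) :
    expOf ∘ vertex n = ![expo n 0 0, expo 0 1 0, expo 0 0 1] := by
  funext j
  fin_cases j <;> simp [vertex, expOf_eq_iff]

theorem wt_vertex (n : ℕ) (j : Fin 3) : wt n (vertex n j) = n := by
  rw [wt_eq_weight_expOf, ← Function.comp_apply (f := expOf), expOf_vertex]
  fin_cases j <;> simp [weight_varWt_expo]

theorem expOf_epsExp (n i : ℕ) : expOf (epsExp n i) = basisExpo n i := by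
  rw [expOf_eq_iff, epsExp, basisExpo]
  split_ifs <;> simp
  omega

theorem finite_setOf_wt_lt {n : ℕ} (hn : 0 < n) (B : ℕ) : {u : ℤ × ℤ | wt n u < B}.Finite := by
  refine ((Set.finite_Icc (-(B : ℤ)) B).prod (Set.finite_Icc (-(B : ℤ)) B)).subset fun u hu => ?_
  have hwt : (wt n u : ℤ) < B := by exact_mod_cast hu
  have hm := mMax_nonneg u
  have hfst := neg_fst_le_mMax u
  have hsnd := neg_snd_le_mMax u
  have hmul : (1 : ℤ) * ((u.2 + mMax u) + mMax u) ≤ n * ((u.2 + mMax u) + mMax u) :=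
    mul_le_mul_of_nonneg_right (by exact_mod_cast hn) (by linarith)
  rw [intCast_wt] at hwt
  simp only [Set.mem_prod, Set.mem_Icc]
  refine ⟨⟨?_, ?_⟩, ?_, ?_⟩ <;> linarith

theorem comap_omega_atTop {n : ℕ} (hn : 0 < n) :
    comap (omega n) atTop = (cofinite : Filter (ℤ × ℤ)) := by
  refine le_antisymm (le_cofinite_iff_compl_singleton_mem.2 fun u => ?_) ?_
  · have hlt : ∀ᶠ v in comap (omega n) atTop, omega n u < omega n v :=
      tendsto_comap.eventually (eventually_gt_atTop (omega n u))
    filter_upwards [hlt] with v hv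
    rintro rfl
    exact lt_irrefl _ hv
  · rw [← tendsto_iff_comap, tendsto_atTop]
    intro b
    obtain ⟨B, hB⟩ := exists_nat_ge (n * b)
    refine (finite_setOf_wt_lt hn B).subset fun u hu => ?_
    have hlt : omega n u < b := not_le.1 hu
    have hn' : (0 : ℚ) < n := by exact_mod_cast hn
    have hwt : (wt n u : ℚ) < B := by
      rw [natCast_wt n hn]
      exact (mul_lt_mul_of_pos_left hlt hn').trans_le hB
    exact_mod_cast hwt

end Weight

/-! ### Modules complete for the powers of an element -/

section Adic

variable {R L M : Type*} [CommRing R] [AddCommGroup L] [Module R L] [AddCommGroup M] [Module R M]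
  {g : R}

theorem mem_span_singleton_pow_smul_top {k : ℕ} {m : M} :
    m ∈ (Ideal.span {g} ^ k • ⊤ : Submodule R M) ↔ ∃ m', m = g ^ k • m' := by
  rw [Ideal.span_singleton_pow, Submodule.ideal_span_singleton_smul,
    Submodule.mem_smul_pointwise_iff_exists]
  simp [eq_comm]

theorem isHausdorff_span_singleton_iff :
    IsHausdorff (Ideal.span {g}) M ↔ ∀ m : M, (∀ k : ℕ, ∃ m', m = g ^ k • m') → m = 0 := by
  simp only [isHausdorff_iff, SModEq.zero, mem_span_singleton_pow_smul_top]

theorem eq_zero_of_forall_eq_smul_succ [IsHausdorff (Ideal.span {g}) M] {d : ℕ → M}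
    (hd : ∀ i, d i = g • d (i + 1)) : d 0 = 0 := by
  refine isHausdorff_span_singleton_iff.1 ‹_› _ fun k => ⟨d k, ?_⟩
  induction k with
  | zero => rw [pow_zero, one_smul]
  | succ k ih => rw [ih, hd k, smul_smul, pow_succ]

/-- The tails `s i = f i + g • f (i + 1) + ⋯` are the remainders of the limit. -/
theorem isPrecomplete_span_singleton
    (h : ∀ f : ℕ → M, ∃ s : ℕ → M, ∀ i, s i = f i + g • s (i + 1)) :
    IsPrecomplete (Ideal.span {g}) M := by
  refine ⟨fun x hx => ?_⟩
  have hdiff : ∀ i, ∃ y, x (i + 1) - x i = g ^ i • y := fun i =>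
    mem_span_singleton_pow_smul_top.1 (SModEq.sub_mem.1 (hx i.le_succ).symm)
  choose f hf using hdiff
  obtain ⟨s, hs⟩ := h f
  have hlim : ∀ i, x 0 + s 0 = x i + g ^ i • s i := fun i => by
    induction i with
    | zero => rw [pow_zero, one_smul]
    | succ i ih => rw [ih, hs i, smul_add, ← hf, smul_smul, pow_succ]; abel
  refine ⟨x 0 + s 0, fun i => (SModEq.sub_mem.2 (mem_span_singleton_pow_smul_top.2 ?_)).symm⟩
  exact ⟨s i, by rw [hlim i, add_sub_cancel_left]⟩

theorem surjective_of_forall_exists_eq_add_smul [IsPrecomplete (Ideal.span {g}) L]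
    [IsHausdorff (Ideal.span {g}) M] {Φ : L →ₗ[R] M} (h : ∀ m, ∃ x m', m = Φ x + g • m') :
    Function.Surjective Φ := by
  refine surjective_of_mkQ_comp_surjective (I := Ideal.span {g}) fun y => ?_
  obtain ⟨m, rfl⟩ := Submodule.mkQ_surjective _ y
  obtain ⟨x, m', rfl⟩ := h m
  refine ⟨x, ((Submodule.Quotient.eq _).2 ?_).symm⟩
  rw [add_sub_cancel_left, Submodule.ideal_span_singleton_smul]
  exact Submodule.smul_mem_pointwise_smul _ _ _ trivial

/-- A relation is divided by `g` after subtracting the trivial relation `(0, δy ζ, -δx ζ)`. -/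
theorem coeff_eq_zero_of_totalMap_eq_zero {ι : Type*} [Fintype ι] [IsHausdorff (Ideal.span {g}) R]
    (hM : ∀ m : M, g • m = 0 → m = 0) {δx δy : M →ₗ[R] M} (hcomm : Commute δx δy) {e : ι → M}
    (h : ∀ v ξ η, totalMap e δx δy (v, ξ, η) = 0 →
      (∃ v', v = g • v') ∧ ∃ ζ ξ' η', ξ = δy ζ + g • ξ' ∧ η = -δx ζ + g • η')
    {x : (ι → R) × M × M} (hx : totalMap e δx δy x = 0) : x.1 = 0 := by
  have hdvd : ∀ (k : ℕ) (x : (ι → R) × M × M), totalMap e δx δy x = 0 →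
      ∃ v, x.1 = g ^ k • v := by
    intro k
    induction k with
    | zero => exact fun x _ => ⟨x.1, by rw [pow_zero, one_smul]⟩
    | succ k ih =>
      rintro ⟨v, ξ, η⟩ hx
      obtain ⟨⟨v', rfl⟩, ζ, ξ', η', rfl, rfl⟩ := h v ξ η hx
      have htriv : totalMap e δx δy (0, δy ζ, -δx ζ) = 0 := by
        have hζ : δx (δy ζ) = δy (δx ζ) := LinearMap.congr_fun hcomm ζ
        simp [totalMap_apply, hζ]
      have hsplit : ((g • v', δy ζ + g • ξ', -δx ζ + g • η') : (ι → R) × M × M)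
          = (0, δy ζ, -δx ζ) + g • (v', ξ', η') := by simp
      rw [hsplit, map_add, htriv, zero_add, map_smul] at hx
      obtain ⟨v, hv⟩ := ih _ (hM _ hx)
      exact ⟨v, by rw [pow_succ', mul_smul, ← hv]⟩
  funext i
  refine isHausdorff_span_singleton_iff.1 ‹_› _ fun k => ?_
  obtain ⟨v, hv⟩ := hdvd k x hx
  exact ⟨v i, congrFun hv i⟩

/-- `S` is the summation `f ↦ ∑ g ^ i • f i`. -/
def IsPowSum (g : R) (S : (ℕ → M) →ₗ[R] M) : Prop :=
  ∀ f, S f = f 0 + g • S fun i => f (i + 1)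

/-- The operator `∑ g ^ i A i`, for a summation `S` as in `IsPowSum`. -/
def opSum (S : (ℕ → M) →ₗ[R] M) (A : ℕ → Module.End R M) : Module.End R M :=
  S ∘ₗ LinearMap.pi A

variable {S : (ℕ → M) →ₗ[R] M}

theorem IsPowSum.map_apply (hS : IsPowSum g S) [IsHausdorff (Ideal.span {g}) M]
    (T : Module.End R M) (f : ℕ → M) : T (S f) = S fun i => T (f i) := by
  refine sub_eq_zero.1 (eq_zero_of_forall_eq_smul_succ (g := g)
    (d := fun k => T (S fun i => f (i + k)) - S fun i => T (f (i + k))) fun k => ?_)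
  rw [hS, hS fun i => T (f (i + k)), map_add, map_smul, smul_sub]
  simp only [zero_add, add_sub_add_left_eq_sub, add_assoc, add_comm 1 k]

theorem IsPowSum.commute_add_opSum (hS : IsPowSum g S) [IsHausdorff (Ideal.span {g}) M]
    {F G : Module.End R M} {A B : ℕ → Module.End R M} (hFG : Commute F G)
    (hAB : ∀ i j, Commute (A i) (B j)) (hcross : ∀ i, ⁅F, B i⁆ = ⁅G, A i⁆) :
    Commute (F + opSum S A) (G + opSum S B) := by
  refine LinearMap.ext fun c => ?_
  have hFGc : F (G c) = G (F c) := LinearMap.congr_fun hFG c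
  have hABc : (S fun i => A i (S fun j => B j c)) = S fun j => B j (S fun i => A i c) := by
    have hB : ∀ d, (opSum S B) d = S fun j => B j d := fun d => rfl
    rw [← hB (S fun i => A i c), hS.map_apply]
    simp only [hB, hS.map_apply (A _)]
    exact congrArg S (funext fun i => congrArg S (funext fun j =>
      LinearMap.congr_fun (hAB i j) c))
  have hcrossc : F (S fun i => B i c) + S (fun i => A i (G c))
      = G (S fun i => A i c) + S fun i => B i (F c) := by
    rw [hS.map_apply, hS.map_apply, ← map_add, ← map_add]
    refine congrArg S (funext fun i => ?_)
    have hi : F (B i c) - B i (F c) = G (A i c) - A i (G c) := LinearMap.congr_fun (hcross i) c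
    exact sub_eq_sub_iff_add_eq_add.1 hi
  change F (G c + S fun i => B i c) + S (fun i => A i (G c + S fun j => B j c))
    = G (F c + S fun i => A i c) + S fun j => B j (F c + S fun i => A i c)
  have hadd : ∀ (C : ℕ → Module.End R M) (d d' : M),
      (S fun i => C i (d + d')) = (S fun i => C i d) + S fun i => C i d' := fun C d d' =>
    map_add (opSum S C) d d'
  rw [map_add, map_add, hadd, hadd, hFGc, hABc, add_assoc, ← add_assoc (F _), hcrossc]
  abel

end Adic

/-! ### Operators on `C₀` -/

section Space

variable {p : ℕ} [Fact p.Prime] {a n : ℕ} {g : ℂ_[p]}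

theorem mem_C0_iff (hg : g ≠ 0) (hn : 0 < n) {c : ℤ × ℤ → ℂ_[p]} :
    c ∈ C0 p a n g ↔ (∀ u, c u / g ^ wt n u ∈ ZqAdjoin p a g) ∧
      Tendsto (fun u => c u / g ^ wt n u) cofinite (𝓝 0) := by
  have hgu : ∀ u, g ^ wt n u ≠ 0 := fun u => pow_ne_zero _ hg
  rw [← comap_omega_atTop hn]
  constructor
  · rintro ⟨ξ, hξ, hc⟩
    have hdiv : ∀ u, c u / g ^ wt n u = ξ u := fun u => by
      rw [hc, mul_div_cancel_right₀ _ (hgu u)]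
    simp only [hdiv]
    exact ⟨fun u => (ξ u).2, tendsto_zero_iff_norm_tendsto_zero.2 hξ⟩
  · rintro ⟨hmem, hlim⟩
    exact ⟨fun u => ⟨_, hmem u⟩, tendsto_zero_iff_norm_tendsto_zero.1 hlim,
      fun u => (div_mul_cancel₀ _ (hgu u)).symm⟩

/-- The coefficient `ξ(u)` of `∑ ξ(u) g ^ wt n u x ^ u.1 y ^ u.2`. -/
def normCoeff (u : ℤ × ℤ) : C0 p a n g →ₗ[ZqAdjoin p a g] ZqAdjoin p a g where
  toFun c := ⟨(c : ℤ × ℤ → ℂ_[p]) u / g ^ wt n u, by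
    obtain ⟨ξ, -, hξ⟩ := c.2
    rw [hξ]
    by_cases hg : g ^ wt n u = 0
    · rw [hg, div_zero]
      exact zero_mem _
    · rw [mul_div_cancel_right₀ _ hg]
      exact (ξ u).2⟩
  map_add' c d := Subtype.ext (add_div _ _ _)
  map_smul' r c := Subtype.ext (mul_div_assoc _ _ _)

theorem coe_normCoeff (c : C0 p a n g) (u : ℤ × ℤ) :
    (normCoeff u c : ℂ_[p]) = (c : ℤ × ℤ → ℂ_[p]) u / g ^ wt n u := rfl

theorem normCoeff_mul (hg : g ≠ 0) (c : C0 p a n g) (u : ℤ × ℤ) :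
    (normCoeff u c : ℂ_[p]) * g ^ wt n u = (c : ℤ × ℤ → ℂ_[p]) u :=
  div_mul_cancel₀ _ (pow_ne_zero _ hg)

theorem tendsto_normCoeff (hg : g ≠ 0) (hn : 0 < n) (c : C0 p a n g) :
    Tendsto (fun u => (normCoeff u c : ℂ_[p])) cofinite (𝓝 0) :=
  ((mem_C0_iff hg hn).1 c.2).2

theorem C0_ext (hg : g ≠ 0) {c d : C0 p a n g} (h : ∀ u, normCoeff u c = normCoeff u d) :
    c = d := by
  ext u
  rw [← normCoeff_mul hg, h, normCoeff_mul hg]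

theorem norm_le_one_of_mem_C0 (hu : IsUniformizer (ZqAdjoin p a g) g) (c : C0 p a n g)
    (u : ℤ × ℤ) : ‖(c : ℤ × ℤ → ℂ_[p]) u‖ ≤ 1 := by
  rw [← normCoeff_mul hu.ne_zero]
  exact hu.norm_le_one (mul_mem (normCoeff u c).2 (pow_mem hu.mem _))

/-- `g` as an element of `ℤ_q[g]`. -/
def gen (a : ℕ) (g : ℂ_[p]) : ZqAdjoin p a g := ⟨g, Algebra.self_mem_adjoin_singleton _ g⟩

/-- The operator `∑ c(u) x ^ u.1 y ^ u.2 ↦ ∑ f(u) c(u) x ^ u.1 y ^ u.2` on `C₀`: it is `x ∂/∂x` for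
`f = fst` and `y ∂/∂y` for `f = snd`. -/
def diag (n : ℕ) (hu : IsUniformizer (ZqAdjoin p a g) g) [NeZero n] (f : ℤ × ℤ →+ ℤ) :
    Module.End (ZqAdjoin p a g) (C0 p a n g) where
  toFun c := ⟨fun u => (f u : ℂ_[p]) * (c : ℤ × ℤ → ℂ_[p]) u, by
    simp only [mem_C0_iff hu.ne_zero (NeZero.pos n), mul_div_assoc, ← coe_normCoeff]
    have hf : ∀ u, (f u : ℂ_[p]) ∈ ZqAdjoin p a g := fun u => intCast_mem _ _
    refine ⟨fun u => mul_mem (hf u) (normCoeff u c).2,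
      squeeze_zero_norm (fun u => ?_) (tendsto_zero_iff_norm_tendsto_zero.1
        (tendsto_normCoeff hu.ne_zero (NeZero.pos n) c))⟩
    rw [norm_mul]
    exact mul_le_of_le_one_left (norm_nonneg _) (hu.norm_le_one (hf u))⟩
  map_add' c d := Subtype.ext (funext fun u => mul_add _ _ _)
  map_smul' r c := Subtype.ext (funext fun u => mul_left_comm _ _ _)

theorem normCoeff_diag (hu : IsUniformizer (ZqAdjoin p a g) g) [NeZero n] (f : ℤ × ℤ →+ ℤ)
    (c : C0 p a n g) (u : ℤ × ℤ) : normCoeff u (diag n hu f c) = f u * normCoeff u c :=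
  Subtype.ext (mul_div_assoc _ _ _)

theorem mulMonomial_div_pow_wt (hg : g ≠ 0) (v u : ℤ × ℤ) (c : C0 p a n g) :
    g ^ wt n v * (c : ℤ × ℤ → ℂ_[p]) (u - v) / g ^ wt n u =
      ((gen a g ^ (wt n (u - v) + wt n v - wt n u) * normCoeff (u - v) c : ZqAdjoin p a g) :
        ℂ_[p]) := by
  have hpow : g ^ (wt n (u - v) + wt n v - wt n u) * g ^ wt n u
      = g ^ wt n (u - v) * g ^ wt n v := by
    rw [← pow_add, Nat.sub_add_cancel (wt_le_wt_sub_add_wt n u v), pow_add]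
  rw [div_eq_iff (pow_ne_zero _ hg), Subring.coe_mul, Subring.coe_pow, mul_right_comm,
    ← normCoeff_mul hg c]
  change _ = g ^ _ * g ^ _ * _
  rw [hpow]
  ring

/-- Multiplication by the monomial `g ^ wt n v x ^ v.1 y ^ v.2` on `C₀`. -/
def mulMonomial (n : ℕ) (hu : IsUniformizer (ZqAdjoin p a g) g) [NeZero n] (v : ℤ × ℤ) :
    Module.End (ZqAdjoin p a g) (C0 p a n g) where
  toFun c := ⟨fun u => g ^ wt n v * (c : ℤ × ℤ → ℂ_[p]) (u - v), by
    simp only [mem_C0_iff hu.ne_zero (NeZero.pos n), mulMonomial_div_pow_wt hu.ne_zero]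
    refine ⟨fun u => Subtype.prop _, squeeze_zero_norm (fun u => ?_)
      (tendsto_zero_iff_norm_tendsto_zero.1 ((tendsto_normCoeff hu.ne_zero (NeZero.pos n) c).comp
        (sub_left_injective (b := v)).tendsto_cofinite))⟩
    rw [Subring.coe_mul, norm_mul]
    exact mul_le_of_le_one_left (norm_nonneg _) (hu.norm_le_one (Subtype.prop _))⟩
  map_add' c d := Subtype.ext (funext fun u => mul_add _ _ _)
  map_smul' r c := Subtype.ext (funext fun u => mul_left_comm _ _ _)

theorem normCoeff_mulMonomial (hu : IsUniformizer (ZqAdjoin p a g) g) [NeZero n] (v : ℤ × ℤ)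
    (c : C0 p a n g) (u : ℤ × ℤ) : normCoeff u (mulMonomial n hu v c) =
      gen a g ^ (wt n (u - v) + wt n v - wt n u) * normCoeff (u - v) c :=
  Subtype.ext (mulMonomial_div_pow_wt hu.ne_zero v u c)

/-! ### Completeness of `C₀` -/

theorem summable_pow_mul (hg : ‖g‖ < 1) {f : ℕ → ℂ_[p]} (hf : ∀ i, ‖f i‖ ≤ 1) :
    Summable fun i => g ^ i * f i := by
  refine Summable.of_norm_bounded (summable_geometric_of_lt_one (norm_nonneg g) hg) fun i => ?_
  rw [norm_mul, norm_pow]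
  exact mul_le_of_le_one_right (by positivity) (hf i)

theorem tsum_pow_mul_eq_add (hg : ‖g‖ < 1) {f : ℕ → ℂ_[p]} (hf : ∀ i, ‖f i‖ ≤ 1) :
    ∑' i, g ^ i * f i = f 0 + g * ∑' i, g ^ i * f (i + 1) := by
  rw [(summable_pow_mul hg hf).tsum_eq_zero_add, pow_zero, one_mul, ← tsum_mul_left]
  simp only [pow_succ', mul_assoc]

/-- The summation `f ↦ ∑ g ^ i f i` on `C₀`. -/
def powSum (n : ℕ) (hu : IsUniformizer (ZqAdjoin p a g) g) [NeZero n] :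
    (ℕ → C0 p a n g) →ₗ[ZqAdjoin p a g] C0 p a n g where
  toFun f := ⟨fun u => ∑' i, g ^ i * (f i : ℤ × ℤ → ℂ_[p]) u, by
    simp only [mem_C0_iff hu.ne_zero (NeZero.pos n), ← tsum_div_const, mul_div_assoc,
      ← coe_normCoeff]
    refine ⟨fun u => tsum_mem_of_isClosed hu.isCompact.isClosed fun i =>
      mul_mem (pow_mem hu.mem i) (Subtype.prop _), ?_⟩
    rw [← tsum_zero (β := ℕ)]
    refine tendsto_tsum_of_dominated_convergence
      (summable_geometric_of_lt_one (norm_nonneg g) hu.norm_lt_one) (fun i => ?_)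
      (Eventually.of_forall fun u i => ?_)
    · simpa using (tendsto_normCoeff hu.ne_zero (NeZero.pos n) (f i)).const_mul (g ^ i)
    · rw [norm_mul, norm_pow]
      exact mul_le_of_le_one_right (by positivity) (hu.norm_le_one (Subtype.prop _))⟩
  map_add' f f' := Subtype.ext <| funext fun u =>
    (tsum_congr fun i => mul_add _ _ _).trans <|
      (summable_pow_mul hu.norm_lt_one fun i => norm_le_one_of_mem_C0 hu (f i) u).tsum_add
        (summable_pow_mul hu.norm_lt_one fun i => norm_le_one_of_mem_C0 hu (f' i) u)
  map_smul' r f := Subtype.ext <| funext fun u =>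
    (tsum_congr fun i => mul_left_comm _ _ _).trans tsum_mul_left

theorem isPowSum_powSum (hu : IsUniformizer (ZqAdjoin p a g) g) [NeZero n] :
    IsPowSum (gen a g) (powSum n hu : (ℕ → C0 p a n g) →ₗ[ZqAdjoin p a g] C0 p a n g) := fun f =>
  Subtype.ext <| funext fun u =>
    tsum_pow_mul_eq_add hu.norm_lt_one fun i => norm_le_one_of_mem_C0 hu (f i) u

theorem exists_eq_add_gen_mul_succ (hu : IsUniformizer (ZqAdjoin p a g) g)
    (f : ℕ → ZqAdjoin p a g) : ∃ s : ℕ → ZqAdjoin p a g, ∀ i, s i = f i + gen a g * s (i + 1) := by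
  refine ⟨fun i => ⟨∑' j, g ^ j * (f (i + j) : ℂ_[p]), tsum_mem_of_isClosed
    hu.isCompact.isClosed fun j => mul_mem (pow_mem hu.mem j) (Subtype.prop _)⟩, fun i => ?_⟩
  refine Subtype.ext ((tsum_pow_mul_eq_add hu.norm_lt_one fun j =>
    hu.norm_le_one (Subtype.prop _)).trans ?_)
  simp only [add_assoc, add_comm 1]
  rfl

theorem isPrecomplete_pi_prod_C0 (hu : IsUniformizer (ZqAdjoin p a g) g) [NeZero n] (ι : Type*) :
    IsPrecomplete (Ideal.span {gen a g}) ((ι → ZqAdjoin p a g) × C0 p a n g × C0 p a n g) := by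
  refine isPrecomplete_span_singleton fun f => ?_
  choose v hv using fun k => exists_eq_add_gen_mul_succ hu fun i => (f i).1 k
  have htail : ∀ (f : ℕ → C0 p a n g) (i : ℕ), powSum n hu (fun j => f (i + j))
      = f i + gen a g • powSum n hu fun j => f (i + 1 + j) := fun f i => by
    rw [isPowSum_powSum hu]
    simp only [add_zero, add_assoc, add_comm 1]
  exact ⟨fun i => (fun k => v k i, powSum n hu fun j => (f (i + j)).2.1,
    powSum n hu fun j => (f (i + j)).2.2), fun i => Prod.ext (funext fun k => hv k i)
    (Prod.ext (htail (fun j => (f j).2.1) i) (htail (fun j => (f j).2.2) i))⟩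

theorem isHausdorff_ZqAdjoin (hu : IsUniformizer (ZqAdjoin p a g) g) :
    IsHausdorff (Ideal.span {gen a g}) (ZqAdjoin p a g) := by
  refine isHausdorff_span_singleton_iff.2 fun r hr => ?_
  have hle : ∀ k : ℕ, ‖(r : ℂ_[p])‖ ≤ ‖g‖ ^ k := fun k => by
    obtain ⟨r', rfl⟩ := hr k
    change ‖g ^ k * (r' : ℂ_[p])‖ ≤ _
    rw [norm_mul, norm_pow]
    exact mul_le_of_le_one_right (by positivity) (hu.norm_le_one r'.2)
  refine Subtype.ext (norm_le_zero_iff.1 ?_)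
  exact ge_of_tendsto' (tendsto_pow_atTop_nhds_zero_of_lt_one (norm_nonneg g) hu.norm_lt_one) hle

theorem isHausdorff_C0 (hu : IsUniformizer (ZqAdjoin p a g) g) :
    IsHausdorff (Ideal.span {gen a g}) (C0 p a n g) := by
  refine isHausdorff_span_singleton_iff.2 fun c hc => C0_ext hu.ne_zero fun u => ?_
  rw [map_zero]
  refine isHausdorff_span_singleton_iff.1 (isHausdorff_ZqAdjoin hu) _ fun k => ?_
  obtain ⟨d, rfl⟩ := hc k
  exact ⟨normCoeff u d, map_smul _ _ _⟩

theorem eq_zero_of_gen_smul_eq_zero (hg : g ≠ 0) {c : C0 p a n g} (h : gen a g • c = 0) :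
    c = 0 := by
  refine Subtype.ext (funext fun u => ?_)
  exact (mul_eq_zero.1 (congrFun (congrArg Subtype.val h) u : g * _ = 0)).resolve_left hg

end Space

/-! ### The reduction of `C₀` modulo `g` -/

section Reduction

variable {p : ℕ} [Fact p.Prime] {a n : ℕ} {g : ℂ_[p]}

/-- The ring `ℤ_q[g] / (g)`. -/
abbrev ResRing (a : ℕ) (g : ℂ_[p]) : Type := ZqAdjoin p a g ⧸ Ideal.span {gen a g}

/-- The reduction map `ℤ_q[g] → ℤ_q[g] / (g)`. -/
abbrev resMap (a : ℕ) (g : ℂ_[p]) : ZqAdjoin p a g →+* ResRing a g :=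
  Ideal.Quotient.mk (Ideal.span {gen a g})

theorem resMap_eq_zero_iff {r : ZqAdjoin p a g} : resMap a g r = 0 ↔ gen a g ∣ r := by
  rw [Ideal.Quotient.eq_zero_iff_mem, Ideal.mem_span_singleton]

theorem resMap_gen : resMap a g (gen a g) = 0 := resMap_eq_zero_iff.2 dvd_rfl

theorem resMap_eq_zero_iff_norm_lt_one (hu : IsUniformizer (ZqAdjoin p a g) g)
    {r : ZqAdjoin p a g} : resMap a g r = 0 ↔ ‖(r : ℂ_[p])‖ < 1 := by
  rw [resMap_eq_zero_iff]
  constructor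
  · rintro ⟨r', rfl⟩
    change ‖g * (r' : ℂ_[p])‖ < 1
    rw [norm_mul]
    exact mul_lt_one_of_nonneg_of_lt_one_left (norm_nonneg _) hu.norm_lt_one
      (hu.norm_le_one r'.2)
  · intro h
    obtain ⟨r', hr', e⟩ := hu.exists_eq_mul r r.2 h
    exact ⟨⟨r', hr'⟩, Subtype.ext e⟩

theorem isDomain_resRing (hu : IsUniformizer (ZqAdjoin p a g) g) : IsDomain (ResRing a g) := by
  have hmem : ∀ r, r ∈ Ideal.span {gen a g} ↔ ‖(r : ℂ_[p])‖ < 1 := fun r => by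
    rw [← Ideal.Quotient.eq_zero_iff_mem, resMap_eq_zero_iff_norm_lt_one hu]
  rw [Ideal.Quotient.isDomain_iff_prime, Ideal.isPrime_iff, Ideal.ne_top_iff_one]
  simp only [hmem]
  refine ⟨by simp, fun {x y} hxy => ?_⟩
  by_contra! h
  have hx := le_antisymm (hu.norm_le_one x.2) h.1
  have hy := le_antisymm (hu.norm_le_one y.2) h.2
  rw [Subring.coe_mul, norm_mul, hx, hy, one_mul] at hxy
  exact lt_irrefl _ hxy

theorem isUnit_natCast_resRing (hu : IsUniformizer (ZqAdjoin p a g) g) {m : ℕ} (hm : ¬ p ∣ m) :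
    IsUnit (m : ResRing a g) := by
  have hp : (p : ResRing a g) = 0 := by
    rw [← map_natCast (resMap a g), resMap_eq_zero_iff_norm_lt_one hu, Subring.coe_natCast,
      norm_p]
    exact inv_p_lt_one
  have hco : IsCoprime (m : ℤ) (p : ℤ) :=
    Nat.isCoprime_iff_coprime.2 (((Fact.out : p.Prime).coprime_iff_not_dvd.2 hm).symm)
  obtain ⟨x, y, hxy⟩ := hco
  have hcast := congrArg (Int.cast : ℤ → ResRing a g) hxy
  push_cast at hcast
  rw [hp, mul_zero, add_zero] at hcast
  exact IsUnit.of_mul_eq_one_right _ hcast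

open MvPolynomial

/-- The polynomial `q` in `x`, `y`, `z = 1 / (x y)` represents the reduction of `c` modulo `g`. It
matters only modulo `x y z`: the product of two weight-normalized monomials is divisible by `g`
unless their exponents lie in a common cone. -/
def Reduces (c : C0 p a n g) (q : MvPolynomial (Fin 3) (ResRing a g)) : Prop :=
  ∀ u, resMap a g (normCoeff u c) = coeff (expOf u) q

variable {c c' : C0 p a n g} {q q' : MvPolynomial (Fin 3) (ResRing a g)}

theorem Reduces.add (h : Reduces c q) (h' : Reduces c' q') : Reduces (c + c') (q + q') :=
  fun u => by rw [map_add, map_add, h, h', coeff_add]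

theorem Reduces.sub (h : Reduces c q) (h' : Reduces c' q') : Reduces (c - c') (q - q') :=
  fun u => by rw [map_sub, map_sub, h, h', coeff_sub]

theorem Reduces.smul (h : Reduces c q) (r : ZqAdjoin p a g) :
    Reduces (r • c) (C (resMap a g r) * q) :=
  fun u => by rw [map_smul, smul_eq_mul, map_mul, h, coeff_C_mul]

theorem Reduces.sum {ι : Type*} {t : Finset ι} {c : ι → C0 p a n g}
    {q : ι → MvPolynomial (Fin 3) (ResRing a g)} (h : ∀ i ∈ t, Reduces (c i) (q i)) :
    Reduces (∑ i ∈ t, c i) (∑ i ∈ t, q i) := fun u => by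
  rw [map_sum, map_sum, coeff_sum]
  exact Finset.sum_congr rfl fun i hi => h i hi u

theorem reduces_gen_smul (c : C0 p a n g) : Reduces (gen a g • c) 0 := fun u => by
  rw [map_smul, smul_eq_mul, map_mul, resMap_gen, zero_mul, coeff_zero]

theorem Reduces.dvd_sub (h : Reduces c q) (h' : Reduces c q') : xyz (ResRing a g) ∣ q - q' := by
  refine monomial_one_dvd_iff.2 fun d hd => ?_
  obtain ⟨u, rfl⟩ := exists_expOf_eq hd
  rw [coeff_sub, ← h, ← h', sub_self]

theorem exists_reduces (hu : IsUniformizer (ZqAdjoin p a g) g) [NeZero n] (c : C0 p a n g) :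
    ∃ q, Reduces c q := by
  have hlim := tendsto_zero_iff_norm_tendsto_zero.1 (tendsto_normCoeff hu.ne_zero (NeZero.pos n) c)
  have hfin : {u | ¬ ‖(normCoeff u c : ℂ_[p])‖ < 1}.Finite :=
    hlim.eventually (eventually_lt_nhds one_pos)
  refine ⟨∑ u ∈ hfin.toFinset, monomial (expOf u) (resMap a g (normCoeff u c)), fun u => ?_⟩
  classical
  simp only [coeff_sum, coeff_monomial, expOf_injective.eq_iff, Finset.sum_ite_eq']
  split_ifs with h
  · rfl
  · rw [Set.Finite.mem_toFinset, Set.mem_ofPred_eq, not_not] at h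
    exact (resMap_eq_zero_iff_norm_lt_one hu).2 h

theorem exists_reduces_of_polynomial (hg : g ≠ 0) [NeZero n]
    (q : MvPolynomial (Fin 3) (ResRing a g)) : ∃ c : C0 p a n g, Reduces c q := by
  classical
  have hlift : ∀ x : ResRing a g, ∃ r, resMap a g r = x ∧ (x = 0 → r = 0) := fun x => by
    by_cases hx : x = 0
    · exact ⟨0, by rw [map_zero, hx], fun _ => rfl⟩
    · obtain ⟨r, hr⟩ := Ideal.Quotient.mk_surjective x
      exact ⟨r, hr, fun h => absurd h hx⟩
  choose r hr hr0 using hlift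
  have hdiv : ∀ u, (r (coeff (expOf u) q) : ℂ_[p]) * g ^ wt n u / g ^ wt n u
      = r (coeff (expOf u) q) := fun u => mul_div_cancel_right₀ _ (pow_ne_zero _ hg)
  have hfin : {u | expOf u ∈ q.support}.Finite :=
    q.support.finite_toSet.preimage expOf_injective.injOn
  refine ⟨⟨fun u => r (coeff (expOf u) q) * g ^ wt n u, (mem_C0_iff hg (NeZero.pos n)).2 ?_⟩,
    fun u => ?_⟩
  · simp only [hdiv]
    refine ⟨fun u => Subtype.prop _, tendsto_const_nhds.congr' ?_⟩
    filter_upwards [hfin.compl_mem_cofinite] with u hu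
    rw [hr0 _ (notMem_support_iff.1 hu), Subring.coe_zero]
  · rw [← hr (coeff (expOf u) q)]
    exact congrArg _ (Subtype.ext (hdiv u))

theorem exists_eq_gen_smul (hg : g ≠ 0) [NeZero n] (h : Reduces c q)
    (hq : xyz (ResRing a g) ∣ q) : ∃ d, c = gen a g • d := by
  have hdvd : ∀ u, gen a g ∣ normCoeff u c := fun u => by
    rw [← resMap_eq_zero_iff, h]
    exact monomial_one_dvd_iff.1 hq _ (not_le_expOf u)
  have hdiv : ∀ u, g⁻¹ * (c : ℤ × ℤ → ℂ_[p]) u / g ^ wt n u = g⁻¹ * normCoeff u c :=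
    fun u => mul_div_assoc _ _ _
  refine ⟨⟨fun u => g⁻¹ * (c : ℤ × ℤ → ℂ_[p]) u, (mem_C0_iff hg (NeZero.pos n)).2 ?_⟩,
    Subtype.ext (funext fun u => (mul_inv_cancel_left₀ hg _).symm)⟩
  simp only [hdiv]
  refine ⟨fun u => ?_, by simpa using (tendsto_normCoeff hg (NeZero.pos n) c).const_mul g⁻¹⟩
  obtain ⟨r, hr⟩ := hdvd u
  rw [hr]
  exact (inv_mul_cancel_left₀ hg (r : ℂ_[p])).symm ▸ r.2

/-! #### Reduction of the operators -/

theorem Reduces.diag (hu : IsUniformizer (ZqAdjoin p a g) g) [NeZero n] (f : ℤ × ℤ →+ ℤ)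
    (h : Reduces c q) :
    Reduces (diag n hu f c)
      (eulerDer ![(f (1, 0) : ResRing a g), f (0, 1), f (-1, -1)] q) := fun u => by
  have hf : (f u : ResRing a g) = Finsupp.weight ![(f (1, 0) : ResRing a g), f (0, 1), f (-1, -1)]
      (expOf u) := by
    rw [eq_expo (expOf u), weight_expo, map_eq_expOf]
    push_cast
    rfl
  rw [normCoeff_diag, map_mul, map_intCast, h, coeff_eulerDer, hf]

theorem Reduces.mulMonomial (hu : IsUniformizer (ZqAdjoin p a g) g) [NeZero n] (v : ℤ × ℤ)
    (h : Reduces c q) : Reduces (mulMonomial n hu v c) (monomial (expOf v) 1 * q) := fun u => by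
  rw [normCoeff_mulMonomial, map_mul, map_pow, resMap_gen, h, coeff_monomial_mul', one_mul]
  split_ifs with hle
  · rw [wt_sub_add_wt hle, Nat.sub_self, pow_zero, one_mul, ← expOf_sub_add_expOf hle,
      add_tsub_cancel_right]
  · rw [zero_pow (Nat.sub_ne_zero_of_lt (wt_lt_wt_sub_add_wt hle)), zero_mul]

theorem Reduces.opSum (hu : IsUniformizer (ZqAdjoin p a g) g) [NeZero n]
    {A : ℕ → Module.End (ZqAdjoin p a g) (C0 p a n g)} (h : Reduces (A 0 c) q) :
    Reduces (opSum (powSum n hu) A c) q := by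
  have hsum : DworkCohomology.opSum (powSum n hu) A c
      = A 0 c + gen a g • powSum n hu fun i => A (i + 1) c := isPowSum_powSum hu _
  rw [hsum, ← add_zero q]
  exact h.add (reduces_gen_smul _)

end Reduction

/-! ### The differential operators -/

section Differential

variable {p : ℕ} [Fact p.Prime] {a n : ℕ} {g : ℂ_[p]}

theorem lie_smul_sum_smul {ι R A : Type*} [CommRing R] [Ring A] [Algebra R A] {t : Finset ι}
    {D : A} {T : ι → A} {d : ι → R} (h : ∀ j, ⁅D, T j⁆ = d j • T j) (r : R) (c : ι → R) :
    ⁅D, r • ∑ j ∈ t, c j • T j⁆ = r • ∑ j ∈ t, (c j * d j) • T j := by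
  have hmul : ∀ j, D * T j - T j * D = d j • T j := h
  rw [Ring.lie_def, mul_smul_comm, smul_mul_assoc, ← smul_sub, Finset.mul_sum, Finset.sum_mul,
    ← Finset.sum_sub_distrib]
  refine congrArg _ (Finset.sum_congr rfl fun j _ => ?_)
  rw [mul_smul_comm, smul_mul_assoc, ← smul_sub, hmul, mul_smul]

section Dwork

variable {ι : Type*} [Fintype ι]

/-- The `i`-th term of `dworkOp`, up to the factor `g ^ i`. -/
def dworkTerm (n : ℕ) (hu : IsUniformizer (ZqAdjoin p a g) g) [NeZero n] (ρ : ℕ → ZqAdjoin p a g)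
    (V : ι → ℤ × ℤ) (s : ι → ZqAdjoin p a g) (f : ℤ × ℤ →+ ℤ) (i : ℕ) :
    Module.End (ZqAdjoin p a g) (C0 p a n g) :=
  ρ i • ∑ j, ((f (V j) : ZqAdjoin p a g) * s j ^ p ^ i) • mulMonomial n hu (p ^ i • V j)

/-- The derivation `x ^ u.1 y ^ u.2 ↦ f(u) x ^ u.1 y ^ u.2`, twisted by the Laurent polynomial
`∑ s(j) x ^ (V j).1 y ^ (V j).2` and its Frobenius transforms. Both `D_x` and `D_y` are of this
form, for `f = fst` and `f = snd`. -/
def dworkOp (n : ℕ) (hu : IsUniformizer (ZqAdjoin p a g) g) [NeZero n] (ρ : ℕ → ZqAdjoin p a g)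
    (V : ι → ℤ × ℤ) (s : ι → ZqAdjoin p a g) (f : ℤ × ℤ →+ ℤ) :
    Module.End (ZqAdjoin p a g) (C0 p a n g) :=
  diag n hu f + opSum (powSum n hu) (dworkTerm n hu ρ V s f)

theorem diag_commute (hu : IsUniformizer (ZqAdjoin p a g) g) [NeZero n] (f f' : ℤ × ℤ →+ ℤ) :
    Commute (diag n hu f) (diag n hu f') :=
  LinearMap.ext fun _ => Subtype.ext (funext fun _ => mul_left_comm _ _ _)

theorem mulMonomial_commute (hu : IsUniformizer (ZqAdjoin p a g) g) [NeZero n] (v v' : ℤ × ℤ) :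
    Commute (mulMonomial n hu v) (mulMonomial n hu v') :=
  LinearMap.ext fun c => Subtype.ext <| funext fun u => by
    change g ^ _ * (g ^ _ * _) = g ^ _ * (g ^ _ * _)
    rw [sub_right_comm, mul_left_comm]

theorem lie_diag_mulMonomial (hu : IsUniformizer (ZqAdjoin p a g) g) [NeZero n]
    (f : ℤ × ℤ →+ ℤ) (v : ℤ × ℤ) :
    ⁅diag n hu f, mulMonomial n hu v⁆ = (f v : ZqAdjoin p a g) • mulMonomial n hu v :=
  LinearMap.ext fun c => Subtype.ext <| funext fun u => by
    change (f u : ℂ_[p]) * (g ^ _ * _) - g ^ _ * ((f (u - v) : ℂ_[p]) * _)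
      = ((f v : ZqAdjoin p a g) : ℂ_[p]) * (g ^ _ * _)
    rw [map_sub, Subring.coe_intCast]
    push_cast
    ring

theorem dworkTerm_commute (hu : IsUniformizer (ZqAdjoin p a g) g) [NeZero n]
    (ρ : ℕ → ZqAdjoin p a g) (V : ι → ℤ × ℤ) (s : ι → ZqAdjoin p a g) (f f' : ℤ × ℤ →+ ℤ)
    (i i' : ℕ) :
    Commute (dworkTerm n hu ρ V s f i) (dworkTerm n hu ρ V s f' i') :=
  .smul_left (.smul_right (Commute.sum_left _ _ _ fun _ _ => Commute.sum_right _ _ _ fun _ _ =>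
    .smul_left (.smul_right (mulMonomial_commute hu _ _) _) _) _) _

theorem lie_diag_dworkTerm (hu : IsUniformizer (ZqAdjoin p a g) g) [NeZero n]
    (ρ : ℕ → ZqAdjoin p a g) (V : ι → ℤ × ℤ) (s : ι → ZqAdjoin p a g) (f f' : ℤ × ℤ →+ ℤ)
    (i : ℕ) :
    ⁅diag n hu f, dworkTerm n hu ρ V s f' i⁆ =
      ρ i • ∑ j, ((p ^ i * (f (V j) * f' (V j)) : ZqAdjoin p a g) * s j ^ p ^ i) •
        mulMonomial n hu (p ^ i • V j) := by
  refine (lie_smul_sum_smul (A := Module.End (ZqAdjoin p a g) (C0 p a n g)) (D := diag n hu f)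
    (fun j => lie_diag_mulMonomial hu f (p ^ i • V j)) (ρ i) _).trans ?_
  refine congrArg _ (Finset.sum_congr rfl fun j _ => congrArg (· • _) ?_)
  have hcast : (f (p ^ i • V j) : ZqAdjoin p a g) = p ^ i * f (V j) := by
    rw [map_nsmul, nsmul_eq_mul]
    push_cast
    rfl
  rw [hcast]
  ring

theorem dworkOp_commute (hu : IsUniformizer (ZqAdjoin p a g) g) [NeZero n]
    (ρ : ℕ → ZqAdjoin p a g) (V : ι → ℤ × ℤ) (s : ι → ZqAdjoin p a g) (f f' : ℤ × ℤ →+ ℤ) :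
    Commute (dworkOp n hu ρ V s f) (dworkOp n hu ρ V s f') := by
  have := isHausdorff_C0 (n := n) hu
  refine (isPowSum_powSum hu).commute_add_opSum (diag_commute hu f f')
    (dworkTerm_commute hu ρ V s f f') fun i => ?_
  simp only [lie_diag_dworkTerm, mul_comm]

theorem Reduces.dworkOp (hu : IsUniformizer (ZqAdjoin p a g) g) [NeZero n]
    {ρ : ℕ → ZqAdjoin p a g} (hρ : ρ 0 = 1) (V : ι → ℤ × ℤ) (s : ι → ZqAdjoin p a g)
    (f : ℤ × ℤ →+ ℤ) {c : C0 p a n g} {q : MvPolynomial (Fin 3) (ResRing a g)}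
    (h : Reduces c q) :
    Reduces (dworkOp n hu ρ V s f c) (twistedDer ![(f (1, 0) : ResRing a g), f (0, 1), f (-1, -1)]
      (∑ j, .monomial (expOf (V j)) (f (V j) * resMap a g (s j))) q) := by
  have hzero : dworkTerm n hu ρ V s f 0 c
      = ∑ j, ((f (V j) : ZqAdjoin p a g) * s j) • DworkCohomology.mulMonomial n hu (V j) c := by
    simp [dworkTerm, hρ]
  have hterm : ∀ j, .C (resMap a g (f (V j) * s j)) * (.monomial (expOf (V j)) 1 * q)
      = MvPolynomial.monomial (expOf (V j)) (f (V j) * resMap a g (s j)) * q := fun j => by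
    rw [← mul_assoc, MvPolynomial.C_mul_monomial, mul_one, map_mul, map_intCast]
  rw [twistedDer_apply, Finset.sum_mul]
  refine (h.diag hu f).add (Reduces.opSum hu ?_)
  rw [hzero]
  simp only [← hterm]
  exact Reduces.sum fun j _ => (h.mulMonomial hu (V j)).smul _

end Dwork

variable {γ : ℂ_[p]} {ρ : ℕ → ZqAdjoin p a g} {s : Zq p a}

/-- The coefficients of the Laurent polynomial `x ^ n + y + s / (x y)`, in the order of
`vertex n`. -/
def vertexCoeff (g : ℂ_[p]) (s : Zq p a) : Fin 3 → ZqAdjoin p a g :=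
  ![1, 1, ⟨((s : Qq p a) : ℂ_[p]), coe_Zq_mem_ZqAdjoin g s⟩]

theorem dworkTerm_apply (hu : IsUniformizer (ZqAdjoin p a g) g) [NeZero n]
    (S : Fin 3 → ZqAdjoin p a g) (f : ℤ × ℤ →+ ℤ) (c : C0 p a n g) (u : ℤ × ℤ) (i : ℕ) :
    (dworkTerm n hu ρ (vertex n) S f i c : ℤ × ℤ → ℂ_[p]) u =
      ρ i * g ^ (n * p ^ i) * ∑ j, (f (vertex n j) : ℂ_[p]) * (S j : ℂ_[p]) ^ p ^ i *
        (c : ℤ × ℤ → ℂ_[p]) (u - p ^ i • vertex n j) := by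
  rw [dworkTerm, LinearMap.smul_apply, LinearMap.sum_apply, mul_assoc, Finset.mul_sum]
  refine congrArg ((ρ i : ℂ_[p]) * ·) ?_
  rw [AddSubmonoidClass.coe_finsetSum, Finset.sum_apply]
  refine Finset.sum_congr rfl fun j _ => ?_
  change (((f (vertex n j) : ZqAdjoin p a g) : ℂ_[p]) * (S j : ℂ_[p]) ^ p ^ i) *
    (g ^ wt n (p ^ i • vertex n j) * (c : ℤ × ℤ → ℂ_[p]) (u - p ^ i • vertex n j)) = _
  rw [wt_nsmul, wt_vertex, Subring.coe_intCast]
  ring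

theorem dworkOp_apply (hu : IsUniformizer (ZqAdjoin p a g) g) [NeZero n]
    (hρ : ∀ i, gammaSeq p γ i * (p : ℂ_[p]) ^ i = ρ i * g ^ i * g ^ (n * p ^ i))
    (S : Fin 3 → ZqAdjoin p a g) (f : ℤ × ℤ →+ ℤ) (c : C0 p a n g) (u : ℤ × ℤ) :
    (dworkOp n hu ρ (vertex n) S f c : ℤ × ℤ → ℂ_[p]) u =
      f u * (c : ℤ × ℤ → ℂ_[p]) u + ∑' i, gammaSeq p γ i * (p : ℂ_[p]) ^ i *
        ∑ j, (f (vertex n j) : ℂ_[p]) * (S j : ℂ_[p]) ^ p ^ i *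
          (c : ℤ × ℤ → ℂ_[p]) (u - p ^ i • vertex n j) := by
  change _ + ∑' i, g ^ i * (dworkTerm n hu ρ (vertex n) S f i c : ℤ × ℤ → ℂ_[p]) u = _
  refine congrArg (_ + ·) (tsum_congr fun i => ?_)
  rw [dworkTerm_apply, hρ]
  ring

theorem coe_dworkOp_fst (hu : IsUniformizer (ZqAdjoin p a g) g) [NeZero n]
    (hρ : ∀ i, gammaSeq p γ i * (p : ℂ_[p]) ^ i = ρ i * g ^ i * g ^ (n * p ^ i))
    (c : C0 p a n g) :
    (dworkOp n hu ρ (vertex n) (vertexCoeff g s) (.fst ℤ ℤ) c : ℤ × ℤ → ℂ_[p]) =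
      Dx p n γ (s : Qq p a) c := funext fun u => by
  rw [dworkOp_apply hu hρ, Dx]
  simp only [Prod.smul_def]
  simp [Fin.sum_univ_three, vertex, vertexCoeff, mul_comm, sub_eq_add_neg]

theorem coe_dworkOp_snd (hu : IsUniformizer (ZqAdjoin p a g) g) [NeZero n]
    (hρ : ∀ i, gammaSeq p γ i * (p : ℂ_[p]) ^ i = ρ i * g ^ i * g ^ (n * p ^ i))
    (c : C0 p a n g) :
    (dworkOp n hu ρ (vertex n) (vertexCoeff g s) (.snd ℤ ℤ) c : ℤ × ℤ → ℂ_[p]) =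
      Dy p γ (s : Qq p a) c := funext fun u => by
  rw [dworkOp_apply hu hρ, Dy]
  simp only [Prod.smul_def]
  simp [Fin.sum_univ_three, vertex, vertexCoeff, sub_eq_add_neg]

theorem Reduces.dworkOp_fst (hu : IsUniformizer (ZqAdjoin p a g) g) [NeZero n] (hρ : ρ 0 = 1)
    (s : Zq p a) {c : C0 p a n g} {q : MvPolynomial (Fin 3) (ResRing a g)} (h : Reduces c q) :
    Reduces (DworkCohomology.dworkOp n hu ρ (vertex n) (vertexCoeff g s) (.fst ℤ ℤ) c)
      (redDx n (resMap a g (vertexCoeff g s 2)) q) := by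
  convert h.dworkOp hu hρ (vertex n) (vertexCoeff g s) (.fst ℤ ℤ) using 1
  have hexp : ∀ j, expOf (vertex n j) = _ := congrFun (expOf_vertex n)
  simp only [redDx, symbX, Fin.sum_univ_three, hexp]
  simp [vertex, vertexCoeff, sub_eq_add_neg]

theorem Reduces.dworkOp_snd (hu : IsUniformizer (ZqAdjoin p a g) g) [NeZero n] (hρ : ρ 0 = 1)
    (s : Zq p a) {c : C0 p a n g} {q : MvPolynomial (Fin 3) (ResRing a g)} (h : Reduces c q) :
    Reduces (DworkCohomology.dworkOp n hu ρ (vertex n) (vertexCoeff g s) (.snd ℤ ℤ) c)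
      (redDy (resMap a g (vertexCoeff g s 2)) q) := by
  convert h.dworkOp hu hρ (vertex n) (vertexCoeff g s) (.snd ℤ ℤ) using 1
  have hexp : ∀ j, expOf (vertex n j) = _ := congrFun (expOf_vertex n)
  simp only [redDy, symbY, Fin.sum_univ_three, hexp]
  simp [vertex, vertexCoeff, sub_eq_add_neg]

end Differential

/-! ### Lifting from the reduction -/

section Lifting

variable {p : ℕ} [Fact p.Prime] {a n : ℕ} {g : ℂ_[p]}

theorem reduces_epsTilde (hg : g ≠ 0) (i : Fin (2 * n + 1)) :
    Reduces (epsTilde p a n g i) (basisMonomial (ResRing a g) n i) := fun u => by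
  classical
  rw [basisMonomial, ← expOf_epsExp, MvPolynomial.coeff_monomial]
  have hcoeff : (normCoeff u (epsTilde p a n g i) : ℂ_[p])
      = (Pi.single (epsExp n i) (g ^ wt n (epsExp n i)) : ℤ × ℤ → ℂ_[p]) u / g ^ wt n u :=
    rfl
  split_ifs with h
  · obtain rfl := expOf_injective h
    rw [Pi.single_eq_same, div_self (pow_ne_zero _ hg)] at hcoeff
    rw [← map_one (resMap a g)]
    exact congrArg _ (Subtype.ext hcoeff)
  · rw [Pi.single_eq_of_ne (fun hu => h (congrArg expOf hu.symm)), zero_div] at hcoeff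
    rw [← map_zero (resMap a g)]
    exact congrArg _ (Subtype.ext hcoeff)

variable {δx δy : C0 p a n g →ₗ[ZqAdjoin p a g] C0 p a n g} {b : ResRing a g}

theorem Reduces.totalMap (hg : g ≠ 0) (hδx : ∀ c q, Reduces c q → Reduces (δx c) (redDx n b q))
    (hδy : ∀ c q, Reduces c q → Reduces (δy c) (redDy b q)) (r : Fin (2 * n + 1) → ZqAdjoin p a g)
    {ξ η : C0 p a n g} {qξ qη : MvPolynomial (Fin 3) (ResRing a g)} (hξ : Reduces ξ qξ)
    (hη : Reduces η qη) :
    Reduces (DworkCohomology.totalMap (epsTilde p a n g) δx δy (r, ξ, η))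
      (DworkCohomology.totalMap (basisMonomial (ResRing a g) n) (redDx n b) (redDy b)
        (fun i => resMap a g (r i), qξ, qη)) := by
  simp only [totalMap_apply, MvPolynomial.smul_eq_C_mul]
  exact (Reduces.sum fun i _ => (reduces_epsTilde hg i).smul (r i)).add
    ((hδx _ _ hξ).add (hδy _ _ hη))

theorem totalMap_surjective (hu : IsUniformizer (ZqAdjoin p a g) g) [NeZero n] (hpn : ¬ p ∣ n)
    (hb : IsUnit b) (hδx : ∀ c q, Reduces c q → Reduces (δx c) (redDx n b q))
    (hδy : ∀ c q, Reduces c q → Reduces (δy c) (redDy b q)) :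
    Function.Surjective (totalMap (epsTilde p a n g) δx δy) := by
  have := isPrecomplete_pi_prod_C0 (n := n) hu (Fin (2 * n + 1))
  have := isHausdorff_C0 (n := n) hu
  refine surjective_of_forall_exists_eq_add_smul (g := gen a g) fun m => ?_
  obtain ⟨q, hq⟩ := exists_reduces hu m
  obtain ⟨⟨v, qξ, qη⟩, hv⟩ :=
    exists_xyz_dvd_sub_totalMap (NeZero.pos n) (isUnit_natCast_resRing hu hpn) hb q
  choose r hr using fun i => Ideal.Quotient.mk_surjective (v i)
  obtain rfl : (fun i => resMap a g (r i)) = v := funext hr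
  obtain ⟨ξ, hξ⟩ := exists_reduces_of_polynomial (n := n) hu.ne_zero qξ
  obtain ⟨η, hη⟩ := exists_reduces_of_polynomial (n := n) hu.ne_zero qη
  obtain ⟨m', hm'⟩ :=
    exists_eq_gen_smul hu.ne_zero (hq.sub (Reduces.totalMap hu.ne_zero hδx hδy r hξ hη)) hv
  exact ⟨(r, ξ, η), m', by rw [← hm', add_sub_cancel]⟩

theorem fst_eq_zero_of_totalMap_eq_zero (hu : IsUniformizer (ZqAdjoin p a g) g) [NeZero n]
    (hpn : ¬ p ∣ n) (hb : IsUnit b) (hcomm : Commute δx δy)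
    (hδx : ∀ c q, Reduces c q → Reduces (δx c) (redDx n b q))
    (hδy : ∀ c q, Reduces c q → Reduces (δy c) (redDy b q))
    {x : (Fin (2 * n + 1) → ZqAdjoin p a g) × C0 p a n g × C0 p a n g}
    (hx : totalMap (epsTilde p a n g) δx δy x = 0) : x.1 = 0 := by
  have := isDomain_resRing hu
  have := isHausdorff_ZqAdjoin hu
  refine coeff_eq_zero_of_totalMap_eq_zero (g := gen a g)
    (fun m => eq_zero_of_gen_smul_eq_zero hu.ne_zero) hcomm (fun r ξ η h => ?_) hx
  obtain ⟨qξ, hξ⟩ := exists_reduces hu ξ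
  obtain ⟨qη, hη⟩ := exists_reduces hu η
  have hred := Reduces.totalMap hu.ne_zero hδx hδy r hξ hη
  have hzero : Reduces (0 : C0 p a n g) 0 := fun u => by
    rw [map_zero, map_zero, MvPolynomial.coeff_zero]
  rw [h] at hred
  have hdvd := hred.dvd_sub hzero
  rw [sub_zero] at hdvd
  obtain ⟨hr, qζ, hqξ, hqη⟩ := eq_zero_of_xyz_dvd_totalMap (NeZero.pos n)
    (isUnit_natCast_resRing hu hpn) hb hdvd
  obtain ⟨ζ, hζ⟩ := exists_reduces_of_polynomial (n := n) hu.ne_zero qζ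
  obtain ⟨ξ', hξ'⟩ := exists_eq_gen_smul hu.ne_zero (hξ.sub (hδy _ _ hζ)) hqξ
  obtain ⟨η', hη'⟩ := exists_eq_gen_smul hu.ne_zero (hη.add (hδx _ _ hζ)) hqη
  choose r' hr' using fun i => resMap_eq_zero_iff.1 (congrFun hr i)
  exact ⟨⟨r', funext hr'⟩, ζ, ξ', η', by rw [← hξ', add_sub_cancel],
    by rw [← hη', add_comm η, neg_add_cancel_left]⟩

theorem isUnit_resMap_teichmuller (ha : 0 < a) (g : ℂ_[p]) {t : Fq p a} (ht : t ≠ 0) {s : Zq p a}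
    (hs : IsTeichmuller p a t s) : IsUnit (resMap a g (vertexCoeff g s 2)) := by
  have hs0 : s ≠ 0 := by
    rintro rfl
    exact ht (by rw [← hs.1, map_zero])
  have hroot : s ^ (p ^ a - 1) = 1 := by
    refine mul_left_cancel₀ hs0 ?_
    rw [← pow_succ', Nat.sub_add_cancel (Nat.one_le_pow a p (Fact.out : p.Prime).pos), hs.2,
      mul_one]
  refine IsUnit.map _ (IsUnit.of_pow_eq_one (n := p ^ a - 1) (Subtype.ext ?_)
    (p_pow_sub_one_pos ha).ne')
  have hcoe := congrArg (fun z : Zq p a => ((z : Qq p a) : ℂ_[p])) hroot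
  simpa [vertexCoeff] using hcoe

end Lifting

/-! ### The top cohomology -/

section TopCohomology

variable {R M ι : Type*} [CommRing R] [AddCommGroup M] [Module R M] {δx δy : M →ₗ[R] M}
  {e : ι → M}

theorem d1_comp_d0_of_commute (h : Commute δx δy) : d1 δx δy ∘ₗ d0 δx δy = 0 :=
  LinearMap.ext fun m => sub_eq_zero.2 (LinearMap.congr_fun h m)

variable [Fintype ι]

theorem linearIndependent_H2 (hzero : ∀ x, totalMap e δx δy x = 0 → x.1 = 0) :
    LinearIndependent R fun i => (Submodule.Quotient.mk (e i) : H2 δx δy) := by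
  refine Fintype.linearIndependent_iff.2 fun v hv => congrFun ?_
  have hmem : ∑ i, v i • e i ∈ LinearMap.range (d1 δx δy) := by
    rw [← Submodule.Quotient.mk_eq_zero, ← Submodule.mkQ_apply, map_sum]
    simpa using hv
  obtain ⟨⟨ξ, η⟩, hξη⟩ := hmem
  refine hzero (v, -η, ξ) ?_
  rw [totalMap_apply, ← hξη]
  simp [d1]

theorem span_H2_eq_top (hsurj : Function.Surjective (totalMap e δx δy)) :
    Submodule.span R (Set.range fun i => (Submodule.Quotient.mk (e i) : H2 δx δy)) = ⊤ := by
  refine Submodule.eq_top_iff'.2 fun y => ?_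
  obtain ⟨m, rfl⟩ := Submodule.mkQ_surjective _ y
  obtain ⟨⟨v, ξ, η⟩, rfl⟩ := hsurj m
  have hmem : δx ξ + δy η ∈ LinearMap.range (d1 δx δy) := ⟨(-η, ξ), by simp [d1]⟩
  rw [totalMap_apply, map_add, Submodule.mkQ_apply _ (δx ξ + δy η),
    (Submodule.Quotient.mk_eq_zero _).2 hmem, add_zero, map_sum]
  exact (Submodule.mem_span_range_iff_exists_fun R).2 ⟨v, rfl⟩

theorem exists_basis_H2 (hsurj : Function.Surjective (totalMap e δx δy))
    (hzero : ∀ x, totalMap e δx δy x = 0 → x.1 = 0) :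
    ∃ b : Module.Basis ι R (H2 δx δy), ∀ i, b i = Submodule.Quotient.mk (e i) :=
  ⟨.mk (linearIndependent_H2 hzero) (span_H2_eq_top hsurj).ge, fun _ => Module.Basis.mk_apply ..⟩

theorem coeAddMonoidHom_option (A : Option ι → Submodule R M) [DecidableEq ι]
    (x : DirectSum (Option ι) fun o => A o) :
    DirectSum.coeAddMonoidHom A x = (x none : M) + ∑ i, (x (some i) : M) := by
  classical
  rw [DirectSum.coeAddMonoidHom_eq_dfinsuppSum, DFinsupp.sum_eq_sum_fintype _ (by simp),
    Fintype.sum_option]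
  rfl

theorem isInternal_option [DecidableEq ι] (hsurj : Function.Surjective (totalMap e δx δy))
    (hzero : ∀ x, totalMap e δx δy x = 0 → x.1 = 0) :
    DirectSum.IsInternal fun o : Option ι =>
      o.elim (LinearMap.range δx ⊔ LinearMap.range δy) fun i => Submodule.span R {e i} := by
  set A : Option ι → Submodule R M := fun o =>
    o.elim (LinearMap.range δx ⊔ LinearMap.range δy) fun i => Submodule.span R {e i}
  constructor
  · refine (injective_iff_map_eq_zero _).2 fun x hx => ?_
    rw [coeAddMonoidHom_option] at hx
    obtain ⟨_, ⟨ξ, rfl⟩, _, ⟨η, rfl⟩, hnone⟩ := Submodule.mem_sup.1 (x none).2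
    choose v hv using fun i => Submodule.mem_span_singleton.1 (x (some i)).2
    have hv0 : v = 0 := hzero (v, ξ, η) (by
      simp only [totalMap_apply, hv, hnone]
      rw [add_comm, hx])
    have hsome : ∀ i, (x (some i) : M) = 0 := fun i => by rw [← hv, hv0, Pi.zero_apply, zero_smul]
    refine DFinsupp.ext fun o => Subtype.ext ?_
    rcases o with _ | i
    · simpa [hsome] using hx
    · exact hsome i
  · intro m
    obtain ⟨⟨v, ξ, η⟩, rfl⟩ := hsurj m
    refine ⟨DirectSum.of (fun o => A o) none
        ⟨δx ξ + δy η, Submodule.add_mem_sup ⟨ξ, rfl⟩ ⟨η, rfl⟩⟩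
      + ∑ i, DirectSum.of (fun o => A o) (some i)
        ⟨v i • e i, Submodule.smul_mem _ _ (Submodule.mem_span_singleton_self _)⟩, ?_⟩
    rw [map_add, map_sum, totalMap_apply, add_comm]
    simp only [DirectSum.coeAddMonoidHom_of]

end TopCohomology

end DworkCohomology

end

theorem theorem2p7_general (p : ℕ) [Fact p.Prime] (n : ℕ) (hn : 0 < n) (hpn : ¬ p ∣ n)
    (a : ℕ) (ha : 0 < a)
    (γ : ℂ_[p]) (hγ_zero : HasSum (fun k : ℕ => γ ^ p ^ k / (p : ℂ_[p]) ^ k) 0)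
    (hγ_ord : ‖γ‖ = (p : ℝ) ^ (-(1 / ((p : ℝ) - 1))))
    (g : ℂ_[p]) (hg : g ^ n = γ)
    (t : Fq p a) (ht : t ≠ 0) (s : Zq p a) (hs : IsTeichmuller p a t s) :
    ∃ δx δy : C0 p a n g →ₗ[ZqAdjoin p a g] C0 p a n g,
      (∀ ξ, (δx ξ : ℤ × ℤ → ℂ_[p]) = Dx p n γ (s : Qq p a) ξ) ∧
      (∀ ξ, (δy ξ : ℤ × ℤ → ℂ_[p]) = Dy p γ (s : Qq p a) ξ) ∧
      d1 δx δy ∘ₗ d0 δx δy = 0 ∧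
      (∃ b : Module.Basis (Fin (2 * n + 1)) (ZqAdjoin p a g) (H2 δx δy),
        ∀ i, b i = Submodule.Quotient.mk (epsTilde p a n g i)) ∧
      DirectSum.IsInternal (fun o : Option (Fin (2 * n + 1)) =>
        o.elim (LinearMap.range δx ⊔ LinearMap.range δy)
          (fun i => Submodule.span (ZqAdjoin p a g) {epsTilde p a n g i})) := by
  have : NeZero n := ⟨hn.ne'⟩
  have hγ := norm_pow_sub_one_of_norm_eq hγ_ord
  have hu : IsUniformizer (ZqAdjoin p a g) g := isUniformizer_ZqAdjoin ha hn hg hγ hγ_zero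
  obtain ⟨ρ, hρ0, hρ⟩ := exists_gammaSeq_mul_eq hu hn hg hγ hγ_zero
  set δ := dworkOp n hu ρ (vertex n) (vertexCoeff g s)
  have hcomm : Commute (δ (.fst ℤ ℤ)) (δ (.snd ℤ ℤ)) := dworkOp_commute hu ρ _ _ _ _
  have hδx : ∀ c q, Reduces c q → Reduces (δ (.fst ℤ ℤ) c) _ := fun c q h => h.dworkOp_fst hu hρ0 s
  have hδy : ∀ c q, Reduces c q → Reduces (δ (.snd ℤ ℤ) c) _ := fun c q h => h.dworkOp_snd hu hρ0 s
  have hb := isUnit_resMap_teichmuller ha g ht hs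
  have hsurj := totalMap_surjective hu hpn hb hδx hδy
  have hzero := fun x => fst_eq_zero_of_totalMap_eq_zero hu hpn hb hcomm hδx hδy (x := x)
  exact ⟨δ (.fst ℤ ℤ), δ (.snd ℤ ℤ), coe_dworkOp_fst hu hρ, coe_dworkOp_snd hu hρ,
    d1_comp_d0_of_commute hcomm, exists_basis_H2 hsurj hzero, isInternal_option hsurj hzero⟩

theorem theorem2p7 (p : ℕ) [Fact p.Prime] (hp2 : 2 < p) (n : ℕ) (hn : 0 < n) (hpn : ¬ p ∣ n)
    (a : ℕ) (ha : 0 < a)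
    (ζ : ℂ_[p]) (hζ : IsPrimitiveRoot ζ p)
    (γ : ℂ_[p]) (hγ_mem : γ ∈ IntermediateField.adjoin ℚ_[p] {ζ})
    (hγ_zero : HasSum (fun k : ℕ => γ ^ p ^ k / (p : ℂ_[p]) ^ k) 0)
    (hγ_ord : ‖γ‖ = (p : ℝ) ^ (-(1 / ((p : ℝ) - 1))))
    (g : ℂ_[p]) (hg : g ^ n = γ)
    (t : Fq p a) (ht : t ≠ 0) (s : Zq p a) (hs : IsTeichmuller p a t s) :
    ∃ δx δy : C0 p a n g →ₗ[ZqAdjoin p a g] C0 p a n g,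
      -- `D_x` and `D_y` are well-defined operators on `C₀`, and they define a complex
      (∀ ξ, (δx ξ : ℤ × ℤ → ℂ_[p]) = Dx p n γ (s : Qq p a) ξ) ∧
      (∀ ξ, (δy ξ : ℤ × ℤ → ℂ_[p]) = Dy p γ (s : Qq p a) ξ) ∧
      d1 δx δy ∘ₗ d0 δx δy = 0 ∧
      -- the classes of the `ε̃_i` form a basis of the top cohomology
      (∃ b : Module.Basis (Fin (2 * n + 1)) (ZqAdjoin p a g) (H2 δx δy),
        ∀ i, b i = Submodule.Quotient.mk (epsTilde p a n g i)) ∧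
      -- `C₀ = ⨁ ℤ_q[g] ε̃_i ⊕ (D_x C₀ + D_y C₀)`
      DirectSum.IsInternal (fun o : Option (Fin (2 * n + 1)) =>
        o.elim (LinearMap.range δx ⊔ LinearMap.range δy)
          (fun i => Submodule.span (ZqAdjoin p a g) {epsTilde p a n g i})) :=
  theorem2p7_general p n hn hpn a ha γ hγ_zero hγ_ord g hg t ht s hs
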